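/- Let $(\Omega,\mathcal F,(\mathcal F_t)_{t\ge 0},\mathbb Q)$ be a filtered probability space supporting two standard Brownian motions $W,Z$ with respect to $(\mathcal F_t)$ with $\langle W,Z\rangle_t=\rho t$, $\rho\in(-1,1)$. Let $H\in(0,1)$, $\nu>0$, $H_\pm:=H\pm\frac12$ and $$C_H:=\sqrt{\frac{2H\,\Gamma(2-H_+)}{\Gamma(H_+)\,\Gamma(2-2H)}} .$$ Let the initial forward variance curve $\xi_0(\cdot)>0$ be $\mathcal F_0$-measurable (jointly in $(t,\omega)$), with $\mathbb E\int_0^{t}\xi_0(s)\,\mathrm ds<\infty$ for all $t\ge0$. In the rough Bergomi model the log-price $X$ and its instantaneous variance $V$ satisfy $$\mathrm dX_t=-\tfrac12V_t\,\mathrm dt+\sqrt{V_t}\,\mathrm dW_t,\quad X_0=0,\qquad V_t=\xi_0(t)\exp\Big(2\nu C_H\mathcal V_t-\tfrac12(2\nu C_H)^2[\mathcal V]_t\Big),$$ where $\mathcal V_t:=\int_0^t(t-u)^{H_-}\,\mathrm dZ_u$ and $[\mathcal V]_t:=\int_0^t(t-u)^{2H_-}\,\mathrm du=\frac{t^{2H}}{2H}$;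 that is, $V_t=\xi_0(t)\,\mathcal E(2\nu C_H\mathcal V_t)$ with $\mathcal E$ the Doléans-Dade exponential. For $T\ge0$ and $\Delta>0$ define the VIX at time $T$ by $$\mathrm{VIX}_T:=\Big\{\mathbb E\Big(\frac1\Delta\int_T^{T+\Delta}\mathrm d\langle X,X\rangle_s\,\Big|\,\mathcal F_T\Big)\Big\}^{1/2},$$ where $\langle X,X\rangle$ is the quadratic variation of $X$, and for $t\ge T$ let $$\mathcal V_t^T:=\int_0^T(t-u)^{H_-}\,\mathrm dZ_u,\qquad \eta_T(t):=\exp\big(2\nu C_H\mathcal V_t^T\big),$$ where $\mathcal V$ and $\mathcal V^T$ are taken in versions that are jointly measurable in $(t,\omega)$. Then the realised variance $\frac1\Delta\int_T^{T+\Delta}\mathrm d\langle X,X\rangle_s$ is integrable and, almost surely, the integral below is finite and $$\mathrm{VIX}_T=\left\{\frac1\Delta\int_T^{T+\Delta}\xi_0(t)\,\eta_T(t)\exp\left(\frac{\nu^2C_H^2}{H}\left[(t-T)^{2H}-t^{2H}\right]\right)\mathrm dt\right\}^{1/2}.$$ -/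

import Mathlib

open MeasureTheory ProbabilityTheory Filter Topology
open scoped NNReal ENNReal

namespace RoughBergomi

noncomputable section

/-- `B` is a standard (real) Brownian motion with respect to the filtration `ℱ` under `Q`:
a Brownian motion that is adapted and whose increments after time `s` are independent of `ℱ s`. -/
structure IsFilteredBrownian {Ω : Type*} {mΩ : MeasurableSpace Ω} (Q : Measure Ω)
    (ℱ : Filtration ℝ≥0 mΩ) (B : ℝ≥0 → Ω → ℝ) : Prop where
  brownian : IsBrownianReal B Q
  adapted : ∀ t, Measurable[ℱ t] (B t)
  indep_increment : ∀ s t, s ≤ t →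
    Indep (MeasurableSpace.comap (fun ω => B t ω - B s ω) inferInstance) (ℱ s) Q

/-- Bounded simple adapted processes
`φ_u = ∑_{i < n} c_i 1_{(t_i, t_{i+1}]}(u)`, with `c_i` bounded and `ℱ (t_i)`-measurable. -/
structure SimpleProcess {Ω : Type*} {mΩ : MeasurableSpace Ω} (ℱ : Filtration ℝ≥0 mΩ) where
  n : ℕ
  time : ℕ → ℝ≥0
  time_mono : Monotone time
  coef : ℕ → Ω → ℝ
  coef_measurable : ∀ i, Measurable[ℱ (time i)] (coef i)
  coef_bounded : ∃ C : ℝ, ∀ i ω, |coef i ω| ≤ C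

/-- The value at time `u` of a simple process. -/
def SimpleProcess.value {Ω : Type*} {mΩ : MeasurableSpace Ω} {ℱ : Filtration ℝ≥0 mΩ}
    (φ : SimpleProcess ℱ) (u : ℝ) (ω : Ω) : ℝ :=
  ∑ i ∈ Finset.range φ.n,
    Set.indicator (Set.Ioc (φ.time i : ℝ) (φ.time (i + 1) : ℝ)) (fun _ => φ.coef i ω) u

/-- The elementary stochastic integral `∫_0^t φ dB` of a simple process. -/
def SimpleProcess.integral {Ω : Type*} {mΩ : MeasurableSpace Ω} {ℱ : Filtration ℝ≥0 mΩ}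
    (φ : SimpleProcess ℱ) (B : ℝ≥0 → Ω → ℝ) (t : ℝ≥0) (ω : Ω) : ℝ :=
  ∑ i ∈ Finset.range φ.n,
    φ.coef i ω * (B (min (φ.time (i + 1)) t) ω - B (min (φ.time i) t) ω)

/-- `I` is (a version of) the Itô integral `∫_0^t φ_u dB_u`: the `L²(Q)`-limit of the integrals
of simple adapted processes that converge to `φ` in `L²((0, t] × Ω)`. By the Itô isometry `I` is
determined by `φ` up to a `Q`-null set. For deterministic `φ` it is the Wiener integral. -/
def IsItoIntegral {Ω : Type*} {mΩ : MeasurableSpace Ω} (Q : Measure Ω)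
    (ℱ : Filtration ℝ≥0 mΩ) (B : ℝ≥0 → Ω → ℝ) (φ : ℝ → Ω → ℝ) (t : ℝ≥0) (I : Ω → ℝ) : Prop :=
  AEStronglyMeasurable I Q ∧
  ∃ S : ℕ → SimpleProcess ℱ,
    Tendsto (fun k => eLpNorm (fun p : ℝ × Ω => (S k).value p.1 p.2 - φ p.1 p.2) 2
      ((volume.restrict (Set.Ioc (0 : ℝ) t)).prod Q)) atTop (𝓝 0) ∧
    Tendsto (fun k => eLpNorm (fun ω => (S k).integral B t ω - I ω) 2 Q) atTop (𝓝 0)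

/-- `q` is (a version of) the quadratic variation process `⟨X, X⟩`: for every `t` and every sequence
of partitions `0 = π k 0 ≤ … ≤ π k (N k) = t` of `[0, t]` with mesh tending to `0`, the sums of
squared increments of `X` converge to `q t` in probability. -/
def IsQuadraticVariation {Ω : Type*} {mΩ : MeasurableSpace Ω} (Q : Measure Ω)
    (X q : ℝ≥0 → Ω → ℝ) : Prop :=
  ∀ (t : ℝ≥0) (N : ℕ → ℕ) (π : ℕ → ℕ → ℝ≥0),
    (∀ k, Monotone (π k)) → (∀ k, π k 0 = 0) → (∀ k, π k (N k) = t) →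
    (∀ δ : ℝ≥0, 0 < δ → ∀ᶠ k in atTop, ∀ i < N k, π k (i + 1) ≤ π k i + δ) →
    TendstoInMeasure Q
      (fun k ω => ∑ i ∈ Finset.range (N k), (X (π k (i + 1)) ω - X (π k i) ω) ^ 2)
      atTop (q t)

/-- `C_H = √(2 H Γ(2 - H₊) / (Γ(H₊) Γ(2 - 2H)))` with `H₊ = H + 1/2`. -/
def cH (H : ℝ) : ℝ :=
  Real.sqrt (2 * H * Real.Gamma (2 - (H + 1 / 2)) /
    (Real.Gamma (H + 1 / 2) * Real.Gamma (2 - 2 * H)))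

/-- The Volterra kernel `(t - u)^{H₋}` with `H₋ = H - 1/2`. -/
def kernel (H t u : ℝ) : ℝ := (t - u) ^ (H - 1 / 2)

/-- `[𝒱]_t = ∫_0^t (t - u)^{2 H₋} du` (which is `t^{2H} / (2H)`): the bracket at time `t` of the
martingale `s ↦ ∫_0^s (t - u)^{H₋} dZ_u`, whose value at `s = t` is `𝒱_t`. -/
def volterraBracket (H t : ℝ) : ℝ := ∫ u in (0 : ℝ)..t, kernel H t u ^ 2

/-- The instantaneous variance `V_t = ξ₀(t) ℰ(2 ν C_H 𝒱_t)`, where `ℰ` is the Doléans-Dade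
exponential, `ℰ(c 𝒱_t) = exp (c 𝒱_t - c² [𝒱]_t / 2)`. -/
def instVariance {Ω : Type*} (H ν : ℝ) (ξ₀ 𝒱 : ℝ → Ω → ℝ) (t : ℝ) (ω : Ω) : ℝ :=
  ξ₀ t ω * Real.exp (2 * ν * cH H * 𝒱 t ω - (2 * ν * cH H) ^ 2 * volterraBracket H t / 2)

/-- The rough Bergomi model on the filtered probability space `(Ω, ℱ, Q)`. The processes that are
integrated in time are indexed by `ℝ`, but only their values at times `t ≥ 0` matter. -/
structure IsModel {Ω : Type*} {mΩ : MeasurableSpace Ω} (Q : Measure Ω)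
    (ℱ : Filtration ℝ≥0 mΩ) (H ν ρ : ℝ) (W Z : ℝ≥0 → Ω → ℝ) (ξ₀ 𝒱 : ℝ → Ω → ℝ)
    (X : ℝ≥0 → Ω → ℝ) : Prop where
  H_pos : 0 < H
  H_lt_one : H < 1
  ν_pos : 0 < ν
  ρ_mem : ρ ∈ Set.Ioo (-1 : ℝ) 1
  brownian_W : IsFilteredBrownian Q ℱ W
  brownian_Z : IsFilteredBrownian Q ℱ Z
  /-- `⟨W, Z⟩_t = ρ t` -/
  correlation : Martingale (fun (t : ℝ≥0) ω => W t ω * Z t ω - ρ * (t : ℝ)) ℱ Q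
  ξ₀_pos : ∀ t : ℝ, 0 ≤ t → ∀ ω, 0 < ξ₀ t ω
  /-- the initial forward variance curve is `ℱ 0`-measurable -/
  ξ₀_measurable : Measurable[MeasurableSpace.prod inferInstance (ℱ 0)] (Function.uncurry ξ₀)
  ξ₀_integrable : ∀ t : ℝ≥0,
    Integrable (Function.uncurry ξ₀) ((volume.restrict (Set.Ioc (0 : ℝ) t)).prod Q)
  /-- `𝒱` is a jointly measurable version of `𝒱_t = ∫_0^t (t - u)^{H₋} dZ_u` -/
  volterra_measurable : Measurable (Function.uncurry 𝒱)
  volterra : ∀ t : ℝ≥0, IsItoIntegral Q ℱ Z (fun u _ => kernel H t u) t (𝒱 t)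
  /-- `dX_t = - V_t / 2 dt + √V_t dW_t`, `X_0 = 0` -/
  logPrice : ∃ M : ℝ≥0 → Ω → ℝ,
    (∀ t, IsItoIntegral Q ℱ W (fun u ω => Real.sqrt (instVariance H ν ξ₀ 𝒱 u ω)) t (M t)) ∧
    ∀ t : ℝ≥0, ∀ᵐ ω ∂Q,
      X t ω = -(1 / 2) * (∫ s in (0 : ℝ)..t, instVariance H ν ξ₀ 𝒱 s ω) + M t ω

/-- `𝒱T` is a jointly measurable version of `(𝒱_t^T)_{t ≥ T}`,
`𝒱_t^T = ∫_0^T (t - u)^{H₋} dZ_u`. -/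
structure IsTruncatedVolterra {Ω : Type*} {mΩ : MeasurableSpace Ω} (Q : Measure Ω)
    (ℱ : Filtration ℝ≥0 mΩ) (H : ℝ) (Z : ℝ≥0 → Ω → ℝ) (T : ℝ≥0) (𝒱T : ℝ → Ω → ℝ) : Prop where
  measurable : Measurable (Function.uncurry 𝒱T)
  integral : ∀ t : ℝ, (T : ℝ) ≤ t → IsItoIntegral Q ℱ Z (fun u _ => kernel H t u) T (𝒱T t)

/-- `η_T(t) = exp (2 ν C_H 𝒱_t^T)`. -/
def eta {Ω : Type*} (H ν : ℝ) (𝒱T : ℝ → Ω → ℝ) (t : ℝ) (ω : Ω) : ℝ :=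
  Real.exp (2 * ν * cH H * 𝒱T t ω)

/-- The annualised variance `(1/Δ) ∫_T^{T+Δ} d⟨X, X⟩_s` realised by the log price over
`[T, T + Δ]`, where `q = ⟨X, X⟩`. -/
def realisedVariance {Ω : Type*} (q : ℝ≥0 → Ω → ℝ) (T Δ : ℝ≥0) (ω : Ω) : ℝ :=
  1 / (Δ : ℝ) * (q (T + Δ) ω - q T ω)

/-- `VIX_T = E[(1/Δ) ∫_T^{T+Δ} d⟨X, X⟩_s | ℱ_T]^{1/2}`, where `q = ⟨X, X⟩`. -/
def vix {Ω : Type*} {mΩ : MeasurableSpace Ω} (Q : Measure Ω)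
    (ℱ : Filtration ℝ≥0 mΩ) (q : ℝ≥0 → Ω → ℝ) (T Δ : ℝ≥0) (ω : Ω) : ℝ :=
  Real.sqrt ((Q[realisedVariance q T Δ | ℱ T]) ω)

end

end RoughBergomi

set_option linter.unusedSectionVars false

/-! Since `d⟨X,X⟩ = V dt`, the squared VIX is the time average over `(T, T+Δ]` of `E[V_s | ℱ_T]`.
For `s ≥ T` write `𝒱_s = 𝒱_s^T + R`, where `R` is the Wiener integral of the kernel over `(T, s]`.
The first term is `ℱ_T`-measurable; `R` is independent of `ℱ_T` and Gaussian with variance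
`(s-T)^{2H}/(2H)`. The Gaussian exponential moment of `R` and the compensator in `V_s` give the
factor `exp(ν²C_H²/H [(s-T)^{2H} - s^{2H}])` (`IsModel.condExp_instVariance`). `condExp_integral`
moves the conditional expectation inside the time integral.

The stochastic integrals are known only as `L²` limits of simple integrals, so the calculus is
derived from that. The integrals of elementary processes preserve inner products, and the closure of
their span is the graph of an isometry (`norm_eq_of_mem_itoGraph`). For a deterministic integrand,
replacing the random coefficients of the approximants by their means does not increase the error.
The integral over `(T, s]` is thus a limit of Gaussian sums independent of `ℱ_T`
(`map_restrict_sub_isItoIntegral`).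

For the bracket (`IsQuadraticVariation.ae_eq_integral`) the partitions may be chosen: they refine
the jump times of simple processes `S_k → √V`, with a mesh small compared with the size of `S_k`.
Along them the squared increments of `∫ S_k dW` sum to nearly `∫ S_k² du`, the isometry controls `∫
(S_k - √V) dW`, and the drift has zero quadratic variation. Integrability of `V` on `(0, t] × Ω`
follows because `√V` is a square integrable integrand. -/

namespace RoughBergomi

/-! ### Brownian increments and Gaussian moments -/

section Brownian

variable {Ω : Type*} {mΩ : MeasurableSpace Ω} {Q : Measure Ω}
  {ℱ : Filtration ℝ≥0 mΩ} {B : ℝ≥0 → Ω → ℝ}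

namespace IsFilteredBrownian

lemma measurable (hB : IsFilteredBrownian Q ℱ B) (t : ℝ≥0) : Measurable (B t) :=
  (hB.adapted t).mono (ℱ.le t) le_rfl

lemma hasLaw_increment (hB : IsFilteredBrownian Q ℱ B) {s t : ℝ≥0} (hst : s ≤ t) :
    HasLaw (fun ω => B t ω - B s ω) (gaussianReal 0 (t - s)) Q := by
  have h := hB.brownian.toIsPreBrownianReal.hasLaw_sub t s
  have h2 : nndist t.1 s.1 = t - s := by
    ext
    rw [coe_nndist, Real.dist_eq, NNReal.coe_sub hst]
    exact abs_of_nonneg (sub_nonneg.2 hst)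
  rw [h2] at h
  exact h

lemma memLp_increment (hB : IsFilteredBrownian Q ℱ B) {s t : ℝ≥0} (hst : s ≤ t) {p : ℝ≥0∞}
    (hp : p ≠ ⊤) : MemLp (fun ω => B t ω - B s ω) p Q := by
  have h := (hB.hasLaw_increment hst)
  have h2 : MemLp id p (gaussianReal 0 (t - s)) := memLp_id_gaussianReal' p hp
  rw [← h.map_eq, memLp_map_measure_iff (by fun_prop) h.aemeasurable] at h2
  exact h2

/-- Independence of the increment from `ℱ s` factorises the expectation. The scalar field is general
so that the lemma serves both real moments and complex exponentials. -/
lemma integral_mul_comp_increment {𝕜 : Type*} [RCLike 𝕜]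
    (hB : IsFilteredBrownian Q ℱ B) {s t : ℝ≥0} (hst : s ≤ t) {Y : Ω → 𝕜}
    (hY : Measurable[ℱ s] Y) {g : ℝ → 𝕜} (hg : Measurable g) :
    ∫ ω, Y ω * g (B t ω - B s ω) ∂Q
      = (∫ ω, Y ω ∂Q) * ∫ x, g x ∂(gaussianReal 0 (t - s)) := by
  have hi : IndepFun Y (fun ω => g (B t ω - B s ω)) Q := by
    have h1 : IndepFun Y (fun ω => B t ω - B s ω) Q := by
      rw [IndepFun_iff_Indep]
      exact indep_of_indep_of_le_left (hB.indep_increment s t hst).symm hY.comap_le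
    exact h1.comp measurable_id hg
  have hm : Measurable (fun ω => B t ω - B s ω) := (hB.measurable t).sub (hB.measurable s)
  rw [hi.integral_fun_mul_eq_mul_integral
    (hY.mono (ℱ.le s) le_rfl).aestronglyMeasurable (hg.comp hm).aestronglyMeasurable]
  congr 1
  exact (hB.hasLaw_increment hst).integral_comp hg.aestronglyMeasurable

lemma integral_mul_increment
    (hB : IsFilteredBrownian Q ℱ B) {s t : ℝ≥0} (hst : s ≤ t) {Y : Ω → ℝ}
    (hY : Measurable[ℱ s] Y) : ∫ ω, Y ω * (B t ω - B s ω) ∂Q = 0 := by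
  have h := hB.integral_mul_comp_increment hst hY measurable_id
  simpa using h

end IsFilteredBrownian

lemma integral_sq_gaussianReal (v : ℝ≥0) : ∫ x, x ^ 2 ∂(gaussianReal 0 v) = v := by
  have h := variance_eq_integral (μ := gaussianReal 0 v) (X := id) (by fun_prop)
  rw [variance_id_gaussianReal] at h
  simp only [id] at h
  rw [h]
  simp

/-- The variance of the square of a standard Gaussian variable. -/
noncomputable def gaussianSqVar : ℝ := ∫ x, (x ^ 2 - 1) ^ 2 ∂(gaussianReal 0 1)

lemma gaussianSqVar_nonneg : 0 ≤ gaussianSqVar := integral_nonneg fun _ => sq_nonneg _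

/-- By scaling, `N(0, v)` is the law of `√v` times a standard Gaussian. Only the order `v²` matters
later, so the constant stays unevaluated. -/
lemma integral_sq_sub_sq_gaussianReal (v : ℝ≥0) :
    ∫ x, (x ^ 2 - (v : ℝ)) ^ 2 ∂(gaussianReal 0 v) = v ^ 2 * gaussianSqVar := by
  have h : (gaussianReal 0 1).map (fun x => √(v : ℝ) * x) = gaussianReal 0 v := by
    rw [gaussianReal_map_const_mul]
    congr 1
    · simp
    · ext; simp
  rw [← h, integral_map (by fun_prop) (by fun_prop), gaussianSqVar, ← integral_const_mul]
  congr 1 with x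
  have hv : √(v : ℝ) ^ 2 = v := Real.sq_sqrt v.2
  rw [mul_pow, hv]
  ring

lemma IsFilteredBrownian.integral_mul_sq_increment
    (hB : IsFilteredBrownian Q ℱ B) {s t : ℝ≥0} (hst : s ≤ t) {Y : Ω → ℝ}
    (hY : Measurable[ℱ s] Y) :
    ∫ ω, Y ω * (B t ω - B s ω) ^ 2 ∂Q = (∫ ω, Y ω ∂Q) * (t - s : ℝ) := by
  have h := hB.integral_mul_comp_increment hst hY (g := fun x => x ^ 2) (by fun_prop)
  rw [h, integral_sq_gaussianReal, NNReal.coe_sub hst]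

end Brownian

/-! ### The Itô isometry on the closure of elementary processes -/

section Graph

variable {Ω : Type*} {mΩ : MeasurableSpace Ω}

/-- The values (first component) and the integrals (second component) of the elementary processes
`c 1_{(a, b]}`. -/
def elementaryPairs (Q : Measure Ω) (ℱ : Filtration ℝ≥0 mΩ) (B : ℝ≥0 → Ω → ℝ) :
    Set (Lp ℝ 2 ((volume : Measure ℝ).prod Q) × Lp ℝ 2 Q) :=
  {p | ∃ (a b : ℝ≥0) (c : Ω → ℝ), a ≤ b ∧ Measurable[ℱ a] c ∧ (∃ C : ℝ, ∀ ω, |c ω| ≤ C) ∧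
    (p.1 =ᵐ[(volume : Measure ℝ).prod Q]
      fun x => (Set.Ioc (a : ℝ) b).indicator (fun _ => c x.2) x.1) ∧
    (p.2 =ᵐ[Q] fun ω => c ω * (B b ω - B a ω))}

/-- The graph of the Itô integral on square integrable integrands. -/
noncomputable def itoGraph (Q : Measure Ω) (ℱ : Filtration ℝ≥0 mΩ) (B : ℝ≥0 → Ω → ℝ) :
    Submodule ℝ (Lp ℝ 2 ((volume : Measure ℝ).prod Q) × Lp ℝ 2 Q) :=
  (Submodule.span ℝ (elementaryPairs Q ℱ B)).topologicalClosure

variable {Q : Measure Ω} [IsProbabilityMeasure Q] {ℱ : Filtration ℝ≥0 mΩ} {B : ℝ≥0 → Ω → ℝ}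

lemma integrable_mul_increment_mul_increment (hB : IsFilteredBrownian Q ℱ B)
    {a b a' b' : ℝ≥0} (hab : a ≤ b) (hab' : a' ≤ b') {c : Ω → ℝ} (hc : Measurable c)
    (hcb : ∃ C : ℝ, ∀ ω, |c ω| ≤ C) :
    Integrable (fun ω => c ω * ((B b ω - B a ω) * (B b' ω - B a' ω))) Q := by
  obtain ⟨C, hC⟩ := hcb
  have h1 := (hB.memLp_increment hab (p := 2) ENNReal.ofNat_ne_top).integrable_mul
    (hB.memLp_increment hab' (p := 2) ENNReal.ofNat_ne_top)
  exact h1.bdd_mul hc.aestronglyMeasurable (ae_of_all _ hC)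

/-- The covariance of two elementary integrals whose left endpoints are ordered. -/
lemma integral_elementary_mul_of_le (hB : IsFilteredBrownian Q ℱ B) {a b a' b' : ℝ≥0}
    (hab : a ≤ b) (hab' : a' ≤ b') (haa : a ≤ a') {c c' : Ω → ℝ} (hc : Measurable[ℱ a] c)
    (hcb : ∃ C : ℝ, ∀ ω, |c ω| ≤ C) (hc' : Measurable[ℱ a'] c') (hcb' : ∃ C : ℝ, ∀ ω, |c' ω| ≤ C) :
    ∫ ω, (c ω * (B b ω - B a ω)) * (c' ω * (B b' ω - B a' ω)) ∂Q
      = (∫ ω, c ω * c' ω ∂Q) * max ((min b b' : ℝ) - a') 0 := by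
  have hcc : Measurable[ℱ a'] (fun ω => c ω * c' ω) := (hc.mono (ℱ.mono haa) le_rfl).mul hc'
  have hccm : Measurable (fun ω => c ω * c' ω) := hcc.mono (ℱ.le _) le_rfl
  have hccb : ∃ C : ℝ, ∀ ω, |c ω * c' ω| ≤ C := by
    obtain ⟨C, hC⟩ := hcb
    obtain ⟨C', hC'⟩ := hcb'
    refine ⟨C * C', fun ω => ?_⟩
    rw [abs_mul]
    exact mul_le_mul (hC ω) (hC' ω) (abs_nonneg _) ((abs_nonneg _).trans (hC ω))
  -- An increment ending before `a'` is `ℱ a'`-measurable, so the centred increment after `a'` kills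
  -- the product.
  have early : ∀ {d : ℝ≥0}, a ≤ d → d ≤ a' →
      ∫ ω, (c ω * c' ω) * ((B d ω - B a ω) * (B b' ω - B a' ω)) ∂Q = 0 := by
    intro d had hda
    rw [← hB.integral_mul_increment hab'
      (Y := fun ω => (c ω * c' ω) * (B d ω - B a ω)) ?_]
    · congr 1 with ω; ring
    · exact hcc.mul (((hB.adapted d).mono (ℱ.mono hda) le_rfl).sub
        ((hB.adapted a).mono (ℱ.mono haa) le_rfl))
  -- Splitting the longer increment at `d` leaves a square on the overlap plus an orthogonal
  -- remainder.
  have late : ∀ {d e : ℝ≥0}, a' ≤ d → d ≤ e →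
      ∫ ω, (c ω * c' ω) * ((B d ω - B a' ω) * (B e ω - B a' ω)) ∂Q
        = (∫ ω, c ω * c' ω ∂Q) * ((d : ℝ) - a') := by
    intro d e had hde
    have h0 : ∫ ω, (c ω * c' ω) * ((B d ω - B a' ω) * (B e ω - B d ω)) ∂Q = 0 := by
      rw [← hB.integral_mul_increment hde
        (Y := fun ω => (c ω * c' ω) * (B d ω - B a' ω)) ?_]
      · congr 1 with ω; ring
      · exact (hcc.mono (ℱ.mono had) le_rfl).mul ((hB.adapted d).sub
          ((hB.adapted a').mono (ℱ.mono had) le_rfl))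
    rw [← hB.integral_mul_sq_increment had hcc, ← add_zero (∫ ω, _ * _ ^ 2 ∂Q), ← h0,
      ← integral_add]
    · congr 1 with ω; ring
    · simpa only [sq] using integrable_mul_increment_mul_increment hB had had hccm hccb
    · exact integrable_mul_increment_mul_increment hB had hde hccm hccb
  have hre : ∀ ω, (c ω * (B b ω - B a ω)) * (c' ω * (B b' ω - B a' ω))
      = (c ω * c' ω) * ((B b ω - B a ω) * (B b' ω - B a' ω)) := fun ω => by ring
  simp_rw [hre]
  rcases le_total b a' with hb | hb
  · rw [early hab hb, max_eq_right, mul_zero]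
    have : (min b b' : ℝ) ≤ a' := (min_le_left _ _).trans hb
    linarith
  · have hsplit : ∫ ω, (c ω * c' ω) * ((B b ω - B a ω) * (B b' ω - B a' ω)) ∂Q
        = ∫ ω, (c ω * c' ω) * ((B a' ω - B a ω) * (B b' ω - B a' ω)) ∂Q
          + ∫ ω, (c ω * c' ω) * ((B b ω - B a' ω) * (B b' ω - B a' ω)) ∂Q := by
      rw [← integral_add
        (integrable_mul_increment_mul_increment hB haa hab' hccm hccb)
        (integrable_mul_increment_mul_increment hB hb hab' hccm hccb)]
      congr 1 with ω; ring
    have hm : (a' : ℝ) ≤ min (b : ℝ) b' := le_min hb hab'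
    rw [hsplit, early haa le_rfl, zero_add, max_eq_left (by linarith)]
    rcases le_total b b' with hbb | hbb
    · rw [late hb hbb, min_eq_left (NNReal.coe_le_coe.2 hbb)]
    · rw [min_eq_right (NNReal.coe_le_coe.2 hbb), ← late hab' hbb]
      congr 1 with ω; ring

/-- The overlap of the two intervals is `(a', min b b']`. The right-hand side is the one of
`integral_elementary_mul_of_le`, which is the isometry on generators. -/
lemma integral_indicator_mul_indicator {a b a' b' : ℝ≥0} (haa : a ≤ a')
    (c c' : Ω → ℝ) :
    ∫ x : ℝ × Ω, (Set.Ioc (a : ℝ) b).indicator (fun _ => c x.2) x.1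
        * (Set.Ioc (a' : ℝ) b').indicator (fun _ => c' x.2) x.1 ∂((volume : Measure ℝ).prod Q)
      = (∫ ω, c ω * c' ω ∂Q) * max ((min b b' : ℝ) - a') 0 := by
  have h : ∀ x : ℝ × Ω, (Set.Ioc (a : ℝ) b).indicator (fun _ => c x.2) x.1
        * (Set.Ioc (a' : ℝ) b').indicator (fun _ => c' x.2) x.1
      = (Set.Ioc (a' : ℝ) (min b b')).indicator (fun _ => (1 : ℝ)) x.1 * (c x.2 * c' x.2) := by
    intro x
    have haa' : (a : ℝ) ≤ a' := haa
    by_cases h1 : x.1 ∈ Set.Ioc (a' : ℝ) (min b b')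
    · have h2 : x.1 ∈ Set.Ioc (a : ℝ) b := ⟨haa'.trans_lt h1.1, h1.2.trans (min_le_left _ _)⟩
      have h3 : x.1 ∈ Set.Ioc (a' : ℝ) b' := ⟨h1.1, h1.2.trans (min_le_right _ _)⟩
      simp [h1, h2, h3]
    · rw [Set.indicator_of_notMem h1, zero_mul]
      by_cases h3 : x.1 ∈ Set.Ioc (a' : ℝ) b'
      · have h2 : x.1 ∉ Set.Ioc (a : ℝ) b := fun h2 => h1 ⟨h3.1, le_min h2.2 h3.2⟩
        simp [h2]
      · simp [h3]
  simp_rw [h]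
  rw [integral_prod_mul (fun u : ℝ => (Set.Ioc (a' : ℝ) (min b b')).indicator (fun _ => (1 : ℝ)) u)
    (fun ω => c ω * c' ω), integral_indicator measurableSet_Ioc, mul_comm]
  simp [Measure.real, ENNReal.toReal_ofReal']

lemma inner_elementary (hB : IsFilteredBrownian Q ℱ B)
    {p q : Lp ℝ 2 ((volume : Measure ℝ).prod Q) × Lp ℝ 2 Q}
    (hp : p ∈ elementaryPairs Q ℱ B) (hq : q ∈ elementaryPairs Q ℱ B) :
    inner ℝ p.1 q.1 = inner ℝ p.2 q.2 := by
  obtain ⟨a, b, c, hab, hc, hcb, hp1, hp2⟩ := hp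
  obtain ⟨a', b', c', hab', hc', hcb', hq1, hq2⟩ := hq
  have e1 : inner ℝ p.1 q.1 = ∫ x : ℝ × Ω, (Set.Ioc (a : ℝ) b).indicator (fun _ => c x.2) x.1
        * (Set.Ioc (a' : ℝ) b').indicator (fun _ => c' x.2) x.1
          ∂((volume : Measure ℝ).prod Q) := by
    rw [L2.inner_def]
    apply integral_congr_ae
    filter_upwards [hp1, hq1] with x h1 h2
    rw [h1, h2]
    simp only [RCLike.inner_apply, conj_trivial]
    ring
  have e2 : inner ℝ p.2 q.2 = ∫ ω, (c ω * (B b ω - B a ω)) * (c' ω * (B b' ω - B a' ω)) ∂Q := by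
    rw [L2.inner_def]
    apply integral_congr_ae
    filter_upwards [hp2, hq2] with x h1 h2
    rw [h1, h2]
    simp only [RCLike.inner_apply, conj_trivial]
    ring
  rw [e1, e2]
  rcases le_total a a' with h | h
  · rw [integral_elementary_mul_of_le hB hab hab' h hc hcb hc' hcb',
      integral_indicator_mul_indicator h]
  · have s1 := integral_elementary_mul_of_le hB hab' hab h hc' hcb' hc hcb
    have s2 := integral_indicator_mul_indicator (Q := Q) (b := b') (b' := b) h c' c
    simp_rw [mul_comm (_ * (B b _ - B a _))]
    rw [s1, ← s2]
    congr 1 with x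
    rw [mul_comm]

/-- The isometry is carried as an identity of inner products because these, unlike norms, extend to
the span by bilinearity. -/
lemma inner_span_elementary (hB : IsFilteredBrownian Q ℱ B)
    {p q : Lp ℝ 2 ((volume : Measure ℝ).prod Q) × Lp ℝ 2 Q}
    (hp : p ∈ Submodule.span ℝ (elementaryPairs Q ℱ B))
    (hq : q ∈ Submodule.span ℝ (elementaryPairs Q ℱ B)) :
    inner ℝ p.1 q.1 = inner ℝ p.2 q.2 := by
  induction hp using Submodule.span_induction with
  | zero => simp
  | add x y _ _ hx hy => simp only [Prod.fst_add, Prod.snd_add, inner_add_left, hx, hy]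
  | smul r x _ hx =>
    simp only [Prod.smul_fst, Prod.smul_snd, real_inner_smul_left, hx]
  | mem x hx =>
    induction hq using Submodule.span_induction with
    | zero => simp
    | add y z _ _ hy hz => simp only [Prod.fst_add, Prod.snd_add, inner_add_right, hy, hz]
    | smul r y _ hy =>
      simp only [Prod.smul_fst, Prod.smul_snd, real_inner_smul_right, hy]
    | mem y hy => exact inner_elementary hB hx hy

/-- The Itô isometry. -/
lemma norm_eq_of_mem_itoGraph (hB : IsFilteredBrownian Q ℱ B)
    {p : Lp ℝ 2 ((volume : Measure ℝ).prod Q) × Lp ℝ 2 Q} (hp : p ∈ itoGraph Q ℱ B) :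
    ‖p.1‖ = ‖p.2‖ := by
  have hcl : IsClosed {p : Lp ℝ 2 ((volume : Measure ℝ).prod Q) × Lp ℝ 2 Q | ‖p.1‖ = ‖p.2‖} :=
    isClosed_eq (by fun_prop) (by fun_prop)
  refine closure_minimal (fun p hp => ?_) hcl hp
  have h := inner_span_elementary hB hp hp
  rw [real_inner_self_eq_norm_sq, real_inner_self_eq_norm_sq] at h
  exact (sq_eq_sq₀ (norm_nonneg _) (norm_nonneg _)).1 h

end Graph

/-! ### Itô integrals as points of the closed graph -/

section HasItoIntegral

variable {Ω : Type*} {mΩ : MeasurableSpace Ω}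

/-- The pair `(φ, I)` lies in the graph of the Itô integral over `(0, ∞)`. -/
def HasItoIntegral (Q : Measure Ω) (ℱ : Filtration ℝ≥0 mΩ) (B : ℝ≥0 → Ω → ℝ)
    (φ : ℝ × Ω → ℝ) (I : Ω → ℝ) : Prop :=
  ∃ (hφ : MemLp φ 2 ((volume : Measure ℝ).prod Q)) (hI : MemLp I 2 Q),
    (hφ.toLp φ, hI.toLp I) ∈ itoGraph Q ℱ B

/-- The restriction of an integrand to the time interval `(s, t]`. -/
noncomputable def onIoc (s t : ℝ≥0) (φ : ℝ × Ω → ℝ) : ℝ × Ω → ℝ :=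
  (Set.Ioc (s : ℝ) t ×ˢ Set.univ).indicator φ

variable {Q : Measure Ω} {ℱ : Filtration ℝ≥0 mΩ} {B : ℝ≥0 → Ω → ℝ}

lemma onIoc_apply (s t : ℝ≥0) (φ : ℝ × Ω → ℝ) (x : ℝ × Ω) :
    onIoc s t φ x = (Set.Ioc (s : ℝ) t).indicator (fun _ => φ x) x.1 := by
  by_cases h : x.1 ∈ Set.Ioc (s : ℝ) t <;> simp [onIoc, Set.indicator, Set.mem_prod, h]

lemma onIoc_sub (s t : ℝ≥0) (φ ψ : ℝ × Ω → ℝ) :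
    onIoc s t (φ - ψ) = onIoc s t φ - onIoc s t ψ := Set.indicator_sub _ _ _

lemma onIoc_sub_onIoc {r s t : ℝ≥0} (hrs : r ≤ s) (hst : s ≤ t) (φ : ℝ × Ω → ℝ) :
    onIoc r t φ - onIoc r s φ = onIoc s t φ := by
  ext x
  have h1 : (r : ℝ) ≤ s := hrs
  have h2 : (s : ℝ) ≤ t := hst
  simp only [Pi.sub_apply, onIoc_apply, Set.indicator, Set.mem_Ioc]
  split_ifs <;> grind

section prob

variable [IsProbabilityMeasure Q]

lemma measurableSet_strip (s t : ℝ) :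
    MeasurableSet (Set.Ioc s t ×ˢ (Set.univ : Set Ω)) :=
  measurableSet_Ioc.prod MeasurableSet.univ

lemma prod_restrict_strip (s t : ℝ) :
    ((volume : Measure ℝ).prod Q).restrict (Set.Ioc s t ×ˢ Set.univ)
      = (volume.restrict (Set.Ioc s t)).prod Q := by
  rw [← Measure.prod_restrict, Measure.restrict_univ]

lemma eLpNorm_onIoc (s t : ℝ≥0) (φ : ℝ × Ω → ℝ) (p : ℝ≥0∞) :
    eLpNorm (onIoc s t φ) p ((volume : Measure ℝ).prod Q)
      = eLpNorm φ p ((volume.restrict (Set.Ioc (s : ℝ) t)).prod Q) := by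
  rw [onIoc, eLpNorm_indicator_eq_eLpNorm_restrict (measurableSet_strip s t), prod_restrict_strip]

lemma memLp_onIoc (s t : ℝ≥0) {φ : ℝ × Ω → ℝ} {p : ℝ≥0∞} :
    MemLp (onIoc s t φ) p ((volume : Measure ℝ).prod Q) ↔
      MemLp φ p ((volume.restrict (Set.Ioc (s : ℝ) t)).prod Q) := by
  rw [onIoc, memLp_indicator_iff_restrict (measurableSet_strip s t), prod_restrict_strip]

namespace HasItoIntegral

variable {φ ψ : ℝ × Ω → ℝ} {I J : Ω → ℝ}

lemma sub (h : HasItoIntegral Q ℱ B φ I) (h' : HasItoIntegral Q ℱ B ψ J) :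
    HasItoIntegral Q ℱ B (φ - ψ) (I - J) := by
  obtain ⟨h1, h2, h3⟩ := h
  obtain ⟨h1', h2', h3'⟩ := h'
  refine ⟨h1.sub h1', h2.sub h2', ?_⟩
  rw [MemLp.toLp_sub h1 h1', MemLp.toLp_sub h2 h2']
  exact Submodule.sub_mem _ h3 h3'

lemma add (h : HasItoIntegral Q ℱ B φ I) (h' : HasItoIntegral Q ℱ B ψ J) :
    HasItoIntegral Q ℱ B (φ + ψ) (I + J) := by
  obtain ⟨h1, h2, h3⟩ := h
  obtain ⟨h1', h2', h3'⟩ := h'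
  refine ⟨h1.add h1', h2.add h2', ?_⟩
  rw [MemLp.toLp_add h1 h1', MemLp.toLp_add h2 h2']
  exact Submodule.add_mem _ h3 h3'

lemma zero : HasItoIntegral Q ℱ B 0 0 :=
  ⟨MemLp.zero, MemLp.zero, by
    rw [MemLp.toLp_zero, MemLp.toLp_zero]
    exact Submodule.zero_mem _⟩

lemma sum {ι : Type*} (s : Finset ι) {φ : ι → ℝ × Ω → ℝ} {I : ι → Ω → ℝ}
    (h : ∀ i ∈ s, HasItoIntegral Q ℱ B (φ i) (I i)) :
    HasItoIntegral Q ℱ B (∑ i ∈ s, φ i) (∑ i ∈ s, I i) := by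
  classical
  induction s using Finset.induction_on with
  | empty => simpa using zero
  | insert a s ha ih =>
    rw [Finset.sum_insert ha, Finset.sum_insert ha]
    exact (h a (Finset.mem_insert_self a s)).add
      (ih fun i hi => h i (Finset.mem_insert_of_mem hi))

/-- The Itô isometry. -/
lemma eLpNorm_eq (hB : IsFilteredBrownian Q ℱ B) (h : HasItoIntegral Q ℱ B φ I) :
    eLpNorm I 2 Q = eLpNorm φ 2 ((volume : Measure ℝ).prod Q) := by
  obtain ⟨h1, h2, h3⟩ := h
  have h4 := norm_eq_of_mem_itoGraph hB h3
  simp only [Lp.norm_toLp] at h4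
  exact ((ENNReal.toReal_eq_toReal_iff' h1.eLpNorm_ne_top h2.eLpNorm_ne_top).1 h4).symm

lemma elementary (hB : IsFilteredBrownian Q ℱ B) {a b : ℝ≥0} (hab : a ≤ b) {c : Ω → ℝ}
    (hc : Measurable[ℱ a] c) (hcb : ∃ C : ℝ, ∀ ω, |c ω| ≤ C) :
    HasItoIntegral Q ℱ B (onIoc a b fun x => c x.2) (fun ω => c ω * (B b ω - B a ω)) := by
  obtain ⟨C, hC⟩ := hcb
  have hcm : Measurable c := hc.mono (ℱ.le a) le_rfl
  have h1 : MemLp (onIoc a b fun x => c x.2) 2 ((volume : Measure ℝ).prod Q) := by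
    rw [memLp_onIoc]
    have : IsFiniteMeasure (volume.restrict (Set.Ioc (a : ℝ) b)) := ⟨by simp⟩
    exact MemLp.of_bound (hcm.comp measurable_snd).aestronglyMeasurable C (ae_of_all _ fun x => hC _)
  have h2 : MemLp (fun ω => c ω * (B b ω - B a ω)) 2 Q :=
    (hB.memLp_increment hab (p := 2) ENNReal.ofNat_ne_top).mul' (p := ⊤)
      (memLp_top_of_bound hcm.aestronglyMeasurable C (ae_of_all _ hC))
  refine ⟨h1, h2, Submodule.le_topologicalClosure _ (Submodule.subset_span
    ⟨a, b, c, hab, hc, ⟨C, hC⟩, ?_, h2.coeFn_toLp⟩)⟩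
  filter_upwards [h1.coeFn_toLp] with x hx
  rw [hx, onIoc_apply]

end HasItoIntegral

lemma SimpleProcess.onIoc_value (S : SimpleProcess ℱ) (t : ℝ≥0) :
    onIoc 0 t (fun x => S.value x.1 x.2) = ∑ i ∈ Finset.range S.n,
      onIoc (min (S.time i) t) (min (S.time (i + 1)) t) (fun x => S.coef i x.2) := by
  ext x
  rw [onIoc_apply, Finset.sum_apply]
  simp only [onIoc_apply, SimpleProcess.value]
  by_cases hx : x.1 ∈ Set.Ioc ((0 : ℝ≥0) : ℝ) t
  · rw [Set.indicator_of_mem hx]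
    refine Finset.sum_congr rfl fun i _ => ?_
    obtain ⟨h0, h1⟩ := hx
    simp only [Set.indicator, Set.mem_Ioc, NNReal.coe_min, min_lt_iff, le_min_iff]
    grind
  · rw [Set.indicator_of_notMem hx]
    refine (Finset.sum_eq_zero fun i _ => Set.indicator_of_notMem (fun h => hx ⟨?_, ?_⟩) _).symm
    · exact lt_of_le_of_lt (NNReal.coe_le_coe.2 zero_le) h.1
    · exact h.2.trans (NNReal.coe_le_coe.2 (min_le_right _ _))

lemma SimpleProcess.hasItoIntegral (hB : IsFilteredBrownian Q ℱ B) (S : SimpleProcess ℱ)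
    (t : ℝ≥0) :
    HasItoIntegral Q ℱ B (onIoc 0 t fun x => S.value x.1 x.2) (S.integral B t) := by
  have h2 : S.integral B t = ∑ i ∈ Finset.range S.n,
      fun ω => S.coef i ω * (B (min (S.time (i + 1)) t) ω - B (min (S.time i) t) ω) := by
    ext ω
    rw [Finset.sum_apply]
    rfl
  rw [S.onIoc_value t, h2]
  refine HasItoIntegral.sum _ fun i _ => ?_
  have hmono := S.time_mono (Nat.le_succ i)
  obtain ⟨C, hC⟩ := S.coef_bounded
  rcases le_total (S.time i) t with h | h
  · rw [min_eq_left h]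
    exact HasItoIntegral.elementary hB (le_min hmono h) (S.coef_measurable i) ⟨C, hC i⟩
  -- Here the coefficient need not be `ℱ t`-measurable, but the truncated interval is empty and the
  -- term vanishes.
  · rw [min_eq_right h, min_eq_right (h.trans hmono)]
    convert HasItoIntegral.zero (Q := Q) (ℱ := ℱ) (B := B) using 1
    · ext x; simp [onIoc_apply]
    · ext ω; simp

lemma HasItoIntegral.of_tendsto {φ : ℕ → ℝ × Ω → ℝ} {I : ℕ → Ω → ℝ} {ψ : ℝ × Ω → ℝ} {J : Ω → ℝ}
    (h : ∀ k, HasItoIntegral Q ℱ B (φ k) (I k))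
    (hψ : AEStronglyMeasurable ψ ((volume : Measure ℝ).prod Q)) (hJ : AEStronglyMeasurable J Q)
    (h1 : Tendsto (fun k => eLpNorm (φ k - ψ) 2 ((volume : Measure ℝ).prod Q)) atTop (𝓝 0))
    (h2 : Tendsto (fun k => eLpNorm (I k - J) 2 Q) atTop (𝓝 0)) :
    HasItoIntegral Q ℱ B ψ J := by
  choose hφ hI hmem using h
  have mψ : MemLp ψ 2 ((volume : Measure ℝ).prod Q) := by
    obtain ⟨k, hk⟩ := (h1.eventually_lt_const ENNReal.zero_lt_top).exists
    have : MemLp (φ k - ψ) 2 ((volume : Measure ℝ).prod Q) :=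
      ⟨(hφ k).aestronglyMeasurable.sub hψ, hk⟩
    simpa using (hφ k).sub this
  have mJ : MemLp J 2 Q := by
    obtain ⟨k, hk⟩ := (h2.eventually_lt_const ENNReal.zero_lt_top).exists
    have : MemLp (I k - J) 2 Q := ⟨(hI k).aestronglyMeasurable.sub hJ, hk⟩
    simpa using (hI k).sub this
  refine ⟨mψ, mJ, ?_⟩
  have hc : IsClosed (itoGraph Q ℱ B : Set (Lp ℝ 2 ((volume : Measure ℝ).prod Q) × Lp ℝ 2 Q)) :=
    Submodule.isClosed_topologicalClosure _
  exact hc.mem_of_tendsto (((Lp.tendsto_Lp_iff_tendsto_eLpNorm'' _ hφ _ mψ).2 h1).prodMk_nhds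
    ((Lp.tendsto_Lp_iff_tendsto_eLpNorm'' _ hI _ mJ).2 h2)) (Eventually.of_forall hmem)

/-- Measurability of `φ` is a hypothesis because `IsItoIntegral` does not contain it. Square
integrability of `φ` then comes from being at finite distance from a simple process. -/
lemma IsItoIntegral.hasItoIntegral (hB : IsFilteredBrownian Q ℱ B) {φ : ℝ → Ω → ℝ} {t : ℝ≥0}
    {I : Ω → ℝ} (h : IsItoIntegral Q ℱ B φ t I)
    (hφ : AEStronglyMeasurable (Function.uncurry φ)
      ((volume.restrict (Set.Ioc (0 : ℝ) t)).prod Q)) :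
    HasItoIntegral Q ℱ B (onIoc 0 t (Function.uncurry φ)) I := by
  obtain ⟨hI, S, h1, h2⟩ := h
  refine HasItoIntegral.of_tendsto (fun k => (S k).hasItoIntegral hB t) ?_ hI ?_ h2
  · rw [onIoc, aestronglyMeasurable_indicator_iff (measurableSet_strip _ _), prod_restrict_strip]
    exact hφ
  · convert h1 using 2 with k
    rw [← onIoc_sub, eLpNorm_onIoc]
    rfl

end prob

end HasItoIntegral

/-! ### Conditional expectations of time integrals -/

section General

variable {Ω : Type*} {m mΩ : MeasurableSpace Ω}

lemma eLpNorm_two_sq {α : Type*} {_ : MeasurableSpace α} (f : α → ℝ) (μ : Measure α) :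
    eLpNorm f 2 μ ^ 2 = ∫⁻ x, ‖f x‖ₑ ^ 2 ∂μ := by
  have h := eLpNorm_nnreal_pow_eq_lintegral (f := f) (μ := μ) (p := 2) two_ne_zero
  simpa using h

variable {Q : Measure Ω} [IsProbabilityMeasure Q]

/-- The conditional expectation is self-adjoint. -/
lemma integral_condExp_mul (hm : m ≤ mΩ) {g R : Ω → ℝ}
    (hg : AEStronglyMeasurable g Q) {C : ℝ} (hC : ∀ ω, |g ω| ≤ C) (hR : Integrable R Q) :
    ∫ ω, (Q[g|m]) ω * R ω ∂Q = ∫ ω, g ω * (Q[R|m]) ω ∂Q := by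
  have hgi : Integrable g Q := Integrable.of_bound hg C (ae_of_all _ hC)
  have h1 : Q[Q[g|m] * R|m] =ᵐ[Q] Q[g|m] * Q[R|m] :=
    condExp_stronglyMeasurable_mul_of_bound hm stronglyMeasurable_condExp hR C
      (ae_bdd_abs_condExp_of_ae_bdd_abs (ae_of_all _ hC))
  have h2 : Q[g * Q[R|m]|m] =ᵐ[Q] Q[g|m] * Q[R|m] :=
    condExp_mul_of_stronglyMeasurable_right stronglyMeasurable_condExp
      (integrable_condExp.bdd_mul hg (ae_of_all _ hC)) hgi
  have e1 := integral_condExp (μ := Q) (f := Q[g|m] * R) hm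
  have e2 := integral_condExp (μ := Q) (f := g * Q[R|m]) hm
  rw [integral_congr_ae h1] at e1
  rw [integral_congr_ae h2] at e2
  exact e1.symm.trans e2

lemma integral_integral_mul {μ : Measure ℝ} [SFinite μ] {V : ℝ × Ω → ℝ}
    (hV : Integrable V (μ.prod Q)) {g : Ω → ℝ} (hg : AEStronglyMeasurable g Q) {C : ℝ}
    (hC : ∀ᵐ ω ∂Q, |g ω| ≤ C) :
    ∫ ω, g ω * ∫ s, V (s, ω) ∂μ ∂Q = ∫ s, ∫ ω, g ω * V (s, ω) ∂Q ∂μ := by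
  have hi : Integrable (fun x : ℝ × Ω => g x.2 * V x) (μ.prod Q) :=
    hV.bdd_mul hg.comp_snd (Measure.quasiMeasurePreserving_snd.ae hC)
  rw [← integral_prod _ hi, integral_prod_symm _ hi]
  simp_rw [integral_const_mul]

/-- Integrability of a jointly measurable family of conditional expectations. -/
lemma integrable_of_condExp_eq {μ : Measure ℝ}
    [SFinite μ] {V Y : ℝ × Ω → ℝ} (hV : Integrable V (μ.prod Q))
    (hY : AEStronglyMeasurable Y (μ.prod Q))
    (h : ∀ᵐ s ∂μ, Q[fun ω => V (s, ω)|m] =ᵐ[Q] fun ω => Y (s, ω)) :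
    Integrable Y (μ.prod Q) := by
  rw [integrable_prod_iff hY]
  refine ⟨?_, ?_⟩
  · filter_upwards [h] with s hs
    exact integrable_condExp.congr hs
  · refine hV.norm.integral_prod_left.mono hY.norm.integral_prod_right' ?_
    filter_upwards [h] with s hs
    rw [Real.norm_of_nonneg (integral_nonneg fun _ => norm_nonneg _),
      Real.norm_of_nonneg (integral_nonneg fun _ => norm_nonneg _)]
    -- Conditional expectation contracts `L¹`, so the norms of the slices of `Y` are dominated by
    -- those of `V`.
    have h2 := integral_abs_condExp_le (μ := Q) (m := m) (fun ω => V (s, ω))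
    refine le_trans (le_of_eq (integral_congr_ae ?_)) h2
    filter_upwards [hs] with ω hω
    rw [hω]
    rfl

/-- The conditional expectation commutes with a time integral. -/
lemma condExp_integral (hm : m ≤ mΩ) {μ : Measure ℝ} [SFinite μ]
    {V Y : ℝ × Ω → ℝ} (hV : Integrable V (μ.prod Q)) (hY : Integrable Y (μ.prod Q))
    (h : ∀ᵐ s ∂μ, Q[fun ω => V (s, ω)|m] =ᵐ[Q] fun ω => Y (s, ω)) :
    Q[fun ω => ∫ s, V (s, ω) ∂μ|m] =ᵐ[Q] fun ω => ∫ s, Y (s, ω) ∂μ := by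
  -- The test sets `A` range over all of `mΩ`, so no `m`-measurability of `∫ Y` has to be shown.
  -- Self-adjointness moves the conditional expectation onto the indicator of `A` and, after Fubini,
  -- back onto each slice of `V`.
  refine Integrable.ae_eq_of_forall_setIntegral_eq _ _ integrable_condExp hY.integral_prod_right
    fun A hA _ => ?_
  set g : Ω → ℝ := A.indicator 1 with hg
  have hgm : AEStronglyMeasurable g Q := (measurable_one.indicator hA).aestronglyMeasurable
  have hg1 : ∀ ω, |g ω| ≤ 1 := by
    intro ω
    by_cases hω : ω ∈ A <;> simp [hg, hω]
  have hset : ∀ f : Ω → ℝ, ∫ ω in A, f ω ∂Q = ∫ ω, g ω * f ω ∂Q := by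
    intro f
    rw [← integral_indicator hA]
    congr 1 with ω
    by_cases hω : ω ∈ A <;> simp [hg, hω]
  rw [hset, hset, ← integral_condExp_mul hm hgm hg1 hV.integral_prod_right,
    integral_integral_mul hV (stronglyMeasurable_condExp.mono hm).aestronglyMeasurable
      (ae_bdd_abs_condExp_of_ae_bdd_abs (ae_of_all _ hg1)),
    integral_integral_mul hY hgm (ae_of_all _ hg1)]
  refine integral_congr_ae ?_
  filter_upwards [h, hV.prod_right_ae] with s hs hs2
  rw [integral_condExp_mul hm hgm hg1 hs2]
  refine integral_congr_ae ?_
  filter_upwards [hs] with ω hω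
  rw [hω]

/-- Averaging over `Ω` does not increase the `L²` norm. -/
lemma eLpNorm_integral_le {μ : Measure ℝ} [SFinite μ] {g : ℝ × Ω → ℝ}
    (hg : AEStronglyMeasurable g (μ.prod Q)) :
    eLpNorm (fun x : ℝ × Ω => ∫ ω, g (x.1, ω) ∂Q) 2 (μ.prod Q) ≤ eLpNorm g 2 (μ.prod Q) := by
  have hle : eLpNorm (fun x : ℝ × Ω => ∫ ω, g (x.1, ω) ∂Q) 2 (μ.prod Q) ^ 2
      ≤ eLpNorm g 2 (μ.prod Q) ^ 2 := by
    have hm : AEStronglyMeasurable (fun u => ∫ ω, g (u, ω) ∂Q) μ := hg.integral_prod_right'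
    have h1 : AEMeasurable (fun x : ℝ × Ω => ‖∫ ω, g (x.1, ω) ∂Q‖ₑ ^ 2) (μ.prod Q) :=
      (hm.comp_fst (ν := Q)).enorm.pow_const 2
    rw [eLpNorm_two_sq, eLpNorm_two_sq, lintegral_prod _ h1,
      lintegral_prod _ (hg.enorm.pow_const 2)]
    refine lintegral_mono_ae ?_
    filter_upwards [hg.prodMk_left] with u hu
    simp only [lintegral_const, measure_univ, mul_one]
    rw [← eLpNorm_two_sq]
    gcongr
    refine (enorm_integral_le_lintegral_enorm _).trans ?_
    rw [← eLpNorm_one_eq_lintegral_enorm]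
    exact eLpNorm_le_eLpNorm_of_exponent_le (by norm_num) hu
  exact (ENNReal.pow_le_pow_left_iff two_ne_zero).1 hle

end General

/-! ### Gaussian law of Wiener integrals, jointly with `ℱ T` -/

section Wiener

variable {Ω : Type*} {mΩ : MeasurableSpace Ω} {Q : Measure Ω} [IsProbabilityMeasure Q]
  {ℱ : Filtration ℝ≥0 mΩ} {B : ℝ≥0 → Ω → ℝ}

/-- The Wiener integral of the step function `∑ i < n, d i 1_{(τ i, τ (i + 1)]}`. -/
def stepIntegral (B : ℝ≥0 → Ω → ℝ) (τ : ℕ → ℝ≥0) (d : ℕ → ℝ) (n : ℕ) (ω : Ω) : ℝ :=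
  ∑ i ∈ Finset.range n, d i * (B (τ (i + 1)) ω - B (τ i) ω)

/-- The variance of `stepIntegral`. -/
noncomputable def stepVariance (τ : ℕ → ℝ≥0) (d : ℕ → ℝ) (n : ℕ) : ℝ≥0 :=
  ∑ i ∈ Finset.range n, ‖d i‖₊ ^ 2 * (τ (i + 1) - τ i)

lemma measurable_stepIntegral (hB : IsFilteredBrownian Q ℱ B) {τ : ℕ → ℝ≥0} (hτ : Monotone τ)
    (d : ℕ → ℝ) (n : ℕ) : Measurable[ℱ (τ n)] (stepIntegral B τ d n) := by
  unfold stepIntegral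
  apply Finset.measurable_sum
  intro i hi
  have hi := Finset.mem_range.1 hi
  exact (((hB.adapted _).mono (ℱ.mono (hτ hi)) le_rfl).sub
    ((hB.adapted _).mono (ℱ.mono (hτ hi.le)) le_rfl)).const_mul _

/-- Integrating over an arbitrary `A ∈ ℱ T` encodes law and independence of `ℱ T` at once. The
induction peels off the last increment, independent of `ℱ (τ n)`, which contains `A` because `T ≤ τ
0`. -/
lemma setIntegral_cexp_stepIntegral (hB : IsFilteredBrownian Q ℱ B) {τ : ℕ → ℝ≥0}
    (hτ : Monotone τ) (d : ℕ → ℝ) {T : ℝ≥0} (hT : T ≤ τ 0) {A : Set Ω} (hA : MeasurableSet[ℱ T] A)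
    (θ : ℝ) (n : ℕ) :
    ∫ ω in A, Complex.exp (θ * (stepIntegral B τ d n ω : ℂ) * Complex.I) ∂Q
      = Q.real A * Complex.exp (-(stepVariance τ d n * θ ^ 2 / 2)) := by
  have hA' : MeasurableSet A := ℱ.le T A hA
  rw [← integral_indicator hA']
  induction n with
  | zero =>
    simp only [stepIntegral, stepVariance, Finset.range_zero, Finset.sum_empty]
    rw [integral_indicator hA']
    simp
  | succ n ih =>
    have hst : τ n ≤ τ (n + 1) := hτ n.le_succ
    have hm : Measurable[ℱ (τ n)] (A.indicator fun ω =>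
        Complex.exp (θ * (stepIntegral B τ d n ω : ℂ) * Complex.I)) := by
      have hAn : MeasurableSet[ℱ (τ n)] A := ℱ.mono (hT.trans (hτ n.zero_le)) A hA
      have h1 := measurable_stepIntegral hB hτ d n
      refine Measurable.indicator ?_ hAn
      have h2 : Measurable fun x : ℝ => Complex.exp (θ * (x : ℂ) * Complex.I) := by fun_prop
      exact h2.comp h1
    have h := hB.integral_mul_comp_increment hst hm
      (g := fun x : ℝ => Complex.exp (((θ * d n : ℝ) : ℂ) * x * Complex.I)) (by fun_prop)
    rw [ih, ← charFun_apply_real, charFun_gaussianReal] at h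
    have hl : ∀ ω, A.indicator (fun ω =>
        Complex.exp (θ * (stepIntegral B τ d (n + 1) ω : ℂ) * Complex.I)) ω
        = A.indicator (fun ω =>
          Complex.exp (θ * (stepIntegral B τ d n ω : ℂ) * Complex.I)) ω
          * Complex.exp (((θ * d n : ℝ) : ℂ) * (B (τ (n + 1)) ω - B (τ n) ω : ℝ) * Complex.I) := by
      intro ω
      by_cases hω : ω ∈ A
      · rw [Set.indicator_of_mem hω, Set.indicator_of_mem hω, ← Complex.exp_add]
        congr 1
        simp only [stepIntegral, Finset.sum_range_succ]
        push_cast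
        ring
      · simp [hω]
    simp_rw [hl]
    rw [h, mul_assoc, ← Complex.exp_add]
    congr 2
    simp only [stepVariance, Finset.sum_range_succ]
    have hd : (‖d n‖ : ℂ) ^ 2 = (d n : ℂ) ^ 2 := by
      rw [← Complex.ofReal_pow, Real.norm_eq_abs, sq_abs, Complex.ofReal_pow]
    push_cast
    linear_combination (((τ (n + 1) - τ n : ℝ≥0) : ℝ) : ℂ) * (θ : ℂ) ^ 2 / 2 * hd

lemma map_stepIntegral (hB : IsFilteredBrownian Q ℱ B) {τ : ℕ → ℝ≥0}
    (hτ : Monotone τ) (d : ℕ → ℝ) (n : ℕ) :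
    Q.map (stepIntegral B τ d n) = gaussianReal 0 (stepVariance τ d n) := by
  have hm : Measurable (stepIntegral B τ d n) :=
    (measurable_stepIntegral hB hτ d n).mono (ℱ.le _) le_rfl
  have := Measure.isProbabilityMeasure_map (μ := Q) hm.aemeasurable
  refine Measure.ext_of_charFun (funext fun θ => ?_)
  rw [charFun_apply_real, integral_map hm.aemeasurable
    (by fun_prop), charFun_gaussianReal]
  have h := setIntegral_cexp_stepIntegral hB hτ d le_rfl (MeasurableSet.univ) θ n
  rw [setIntegral_univ] at h
  rw [h]
  simp

lemma integral_stepIntegral_sq (hB : IsFilteredBrownian Q ℱ B) {τ : ℕ → ℝ≥0}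
    (hτ : Monotone τ) (d : ℕ → ℝ) (n : ℕ) :
    ∫ ω, stepIntegral B τ d n ω ^ 2 ∂Q = stepVariance τ d n := by
  have hm : Measurable (stepIntegral B τ d n) :=
    (measurable_stepIntegral hB hτ d n).mono (ℱ.le _) le_rfl
  rw [← integral_sq_gaussianReal, ← map_stepIntegral hB hτ d n,
    integral_map hm.aemeasurable (by fun_prop)]

/-- An `L²` limit of Wiener integrals of step functions after time `T` is centred Gaussian and
independent of `ℱ T`. -/
lemma map_restrict_of_tendsto_stepIntegral (hB : IsFilteredBrownian Q ℱ B) {T : ℝ≥0}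
    {τ : ℕ → ℕ → ℝ≥0} (hτ : ∀ k, Monotone (τ k)) (hT : ∀ k, T ≤ τ k 0) (d : ℕ → ℕ → ℝ)
    (n : ℕ → ℕ) {R : Ω → ℝ} (hR : MemLp R 2 Q)
    (h : Tendsto (fun k => eLpNorm (stepIntegral B (τ k) (d k) (n k) - R) 2 Q) atTop (𝓝 0))
    {A : Set Ω} (hA : MeasurableSet[ℱ T] A) :
    (Q.restrict A).map R = Q A • gaussianReal 0 (∫ ω, R ω ^ 2 ∂Q).toNNReal := by
  have hm : ∀ k, Measurable (stepIntegral B (τ k) (d k) (n k)) := fun k =>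
    (measurable_stepIntegral hB (hτ k) (d k) (n k)).mono (ℱ.le _) le_rfl
  have hLp : ∀ k, MemLp (stepIntegral B (τ k) (d k) (n k)) 2 Q := by
    intro k
    have h2 : MemLp id 2 (gaussianReal 0 (stepVariance (τ k) (d k) (n k))) :=
      memLp_id_gaussianReal 2
    rw [← map_stepIntegral hB (hτ k),
      memLp_map_measure_iff (by fun_prop) (hm k).aemeasurable] at h2
    exact h2
  have hvar : Tendsto (fun k => (stepVariance (τ k) (d k) (n k) : ℝ)) atTop
      (𝓝 (∫ ω, R ω ^ 2 ∂Q)) := by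
    have h1 := (Lp.tendsto_Lp_iff_tendsto_eLpNorm'' _ hLp _ hR).2 h
    have hn : ∀ {f : Ω → ℝ} (hf : MemLp f 2 Q), ‖hf.toLp f‖ ^ 2 = ∫ ω, f ω ^ 2 ∂Q := by
      intro f hf
      rw [← real_inner_self_eq_norm_sq, L2.inner_def]
      refine integral_congr_ae ?_
      filter_upwards [hf.coeFn_toLp] with ω hω
      rw [hω, real_inner_self_eq_norm_sq, Real.norm_eq_abs, sq_abs]
    have h2 := h1.norm.pow 2
    simp only [hn] at h2
    simpa only [integral_stepIntegral_sq hB (hτ _)] using h2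
  have hv0 : 0 ≤ ∫ ω, R ω ^ 2 ∂Q := integral_nonneg fun _ => sq_nonneg _
  obtain ⟨ns, hns, hae⟩ := (tendstoInMeasure_of_tendsto_eLpNorm two_ne_zero
    (fun k => (hm k).aestronglyMeasurable) hR.aestronglyMeasurable h).exists_seq_tendsto_ae
  have hmR : AEMeasurable R (Q.restrict A) := hR.aestronglyMeasurable.aemeasurable.restrict
  have : IsFiniteMeasure (Q A • gaussianReal 0 (∫ ω, R ω ^ 2 ∂Q).toNNReal) :=
    ⟨by simp [measure_lt_top]⟩
  refine Measure.ext_of_charFun (funext fun θ => ?_)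
  rw [charFun_apply_real, charFun_apply_real, integral_map hmR (by fun_prop),
    integral_smul_measure, ← charFun_apply_real, charFun_gaussianReal]
  -- The integrands have modulus one, so almost sure convergence along a subsequence suffices.
  have hl : Tendsto (fun k => ∫ ω in A, Complex.exp (θ *
      (stepIntegral B (τ (ns k)) (d (ns k)) (n (ns k)) ω : ℂ) * Complex.I) ∂Q) atTop
      (𝓝 (∫ ω in A, Complex.exp (θ * (R ω : ℂ) * Complex.I) ∂Q)) := by
    have hc : Continuous fun x : ℝ => Complex.exp (θ * (x : ℂ) * Complex.I) := by fun_prop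
    refine tendsto_integral_of_dominated_convergence (fun _ => (1 : ℝ))
      (fun k => (hc.measurable.comp (hm _)).aestronglyMeasurable) (integrable_const _)
      (fun k => ae_of_all _ fun ω => ?_) ?_
    · rw [← Complex.ofReal_mul, Complex.norm_exp_ofReal_mul_I]
    · filter_upwards [ae_restrict_of_ae hae] with ω hω
      exact (hc.tendsto _).comp hω
  refine tendsto_nhds_unique hl ?_
  simp_rw [fun k => setIntegral_cexp_stepIntegral hB (hτ (ns k)) (d (ns k)) (hT (ns k)) hA θ
    (n (ns k))]
  have hv := hvar.comp hns.tendsto_atTop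
  have hcv : Continuous fun v : ℝ =>
      (Q.real A : ℂ) * Complex.exp (-((v : ℂ) * (θ : ℂ) ^ 2 / 2)) := by fun_prop
  have hlim := (hcv.tendsto _).comp hv
  have he : (Q A).toReal • Complex.exp ((θ : ℂ) * ((0 : ℝ) : ℂ) * Complex.I
      - (((∫ ω, R ω ^ 2 ∂Q).toNNReal : ℝ) : ℂ) * (θ : ℂ) ^ 2 / 2)
      = (Q.real A : ℂ) * Complex.exp (-(((∫ ω, R ω ^ 2 ∂Q : ℝ) : ℂ) * (θ : ℂ) ^ 2 / 2)) := by
    rw [Real.coe_toNNReal _ hv0, Complex.real_smul]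
    simp [Measure.real]
  rw [he]
  exact hlim

/-- The hypothesis `h` says that `R` is `N(0, v)` and independent of `m`. Every set integral of `exp
(c R)` over `A ∈ m` is then `Q A` times the Gaussian moment generating function. -/
lemma condExp_exp_mul_of_map_restrict {Ω : Type*} {m mΩ : MeasurableSpace Ω} {Q : Measure Ω}
    [IsProbabilityMeasure Q] (hm : m ≤ mΩ) {R : Ω → ℝ}
    (hR : AEMeasurable R Q) {v : ℝ≥0}
    (h : ∀ A, MeasurableSet[m] A → (Q.restrict A).map R = Q A • gaussianReal 0 v) (c : ℝ) :
    Integrable (fun ω => Real.exp (c * R ω)) Q ∧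
      Q[fun ω => Real.exp (c * R ω)|m] =ᵐ[Q] fun _ => Real.exp (v * c ^ 2 / 2) := by
  have hi : Integrable (fun ω => Real.exp (c * R ω)) Q := by
    have h1 := h Set.univ MeasurableSet.univ
    rw [Measure.restrict_univ, measure_univ, one_smul] at h1
    have h2 := integrable_exp_mul_gaussianReal (μ := 0) (v := v) c
    rw [← h1, integrable_map_measure (by fun_prop) hR] at h2
    exact h2
  refine ⟨hi, (ae_eq_condExp_of_forall_setIntegral_eq hm hi
    (fun _ _ _ => (integrable_const _).integrableOn) (fun A hA _ => ?_)
    aestronglyMeasurable_const).symm⟩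
  have h3 := mgf_id_gaussianReal (μ := 0) (v := v)
  have h4 : ∫ x, Real.exp (c * x) ∂(gaussianReal 0 v) = Real.exp (v * c ^ 2 / 2) := by
    simpa [mgf] using congrFun h3 c
  have h5 : ∫ ω in A, Real.exp (c * R ω) ∂Q
      = ∫ x, Real.exp (c * x) ∂((Q.restrict A).map R) := by
    rw [integral_map hR.restrict (by fun_prop)]
  rw [h5, h A hA, integral_smul_measure, h4]
  simp [Measure.real]

end Wiener

/-! ### Itô integrals of deterministic functions -/

section WienerIto

variable {Ω : Type*} {mΩ : MeasurableSpace Ω} {Q : Measure Ω} [IsProbabilityMeasure Q]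
  {ℱ : Filtration ℝ≥0 mΩ} {B : ℝ≥0 → Ω → ℝ}

lemma SimpleProcess.measurable_coef (S : SimpleProcess ℱ) (i : ℕ) : Measurable (S.coef i) :=
  (S.coef_measurable i).mono (ℱ.le _) le_rfl

lemma SimpleProcess.integrable_coef (S : SimpleProcess ℱ) (i : ℕ) : Integrable (S.coef i) Q := by
  obtain ⟨C, hC⟩ := S.coef_bounded
  exact Integrable.of_bound (S.measurable_coef i).aestronglyMeasurable C (ae_of_all _ (hC i))

lemma SimpleProcess.measurable_value (S : SimpleProcess ℱ) :
    Measurable (fun x : ℝ × Ω => S.value x.1 x.2) := by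
  unfold SimpleProcess.value
  apply Finset.measurable_sum
  intro i _
  have h : (fun x : ℝ × Ω => (Set.Ioc (S.time i : ℝ) (S.time (i + 1))).indicator
      (fun _ => S.coef i x.2) x.1)
      = (Prod.fst ⁻¹' Set.Ioc (S.time i : ℝ) (S.time (i + 1))).indicator
        (fun x : ℝ × Ω => S.coef i x.2) := by
    ext x
    simp [Set.indicator]
  rw [h]
  exact ((S.measurable_coef i).comp measurable_snd).indicator (measurable_fst measurableSet_Ioc)

lemma SimpleProcess.integrable_value (S : SimpleProcess ℱ) (u : ℝ) :
    Integrable (fun ω => S.value u ω) Q := by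
  unfold SimpleProcess.value
  refine integrable_finsetSum _ fun i _ => ?_
  by_cases hu : u ∈ Set.Ioc (S.time i : ℝ) (S.time (i + 1))
  · simpa [hu] using S.integrable_coef i
  · simp [hu]

lemma SimpleProcess.integral_value (S : SimpleProcess ℱ) (u : ℝ) :
    ∫ ω, S.value u ω ∂Q = ∑ i ∈ Finset.range S.n,
      (Set.Ioc (S.time i : ℝ) (S.time (i + 1))).indicator (fun _ => ∫ ω, S.coef i ω ∂Q) u := by
  unfold SimpleProcess.value
  rw [integral_finsetSum]
  · refine Finset.sum_congr rfl fun i _ => ?_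
    by_cases hu : u ∈ Set.Ioc (S.time i : ℝ) (S.time (i + 1)) <;> simp [hu]
  · intro i _
    by_cases hu : u ∈ Set.Ioc (S.time i : ℝ) (S.time (i + 1))
    · simpa [hu] using S.integrable_coef i
    · simp [hu]

lemma SimpleProcess.measurable_integral (hB : IsFilteredBrownian Q ℱ B) (S : SimpleProcess ℱ)
    (t : ℝ≥0) : Measurable[ℱ t] (S.integral B t) := by
  unfold SimpleProcess.integral
  apply Finset.measurable_sum
  intro i _
  rcases le_total (S.time i) t with h | h
  · exact ((S.coef_measurable i).mono (ℱ.mono h) le_rfl).mul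
      (((hB.adapted _).mono (ℱ.mono (min_le_right _ _)) le_rfl).sub
        ((hB.adapted _).mono (ℱ.mono (min_le_right _ _)) le_rfl))
  · have h' : t ≤ S.time (i + 1) := h.trans (S.time_mono i.le_succ)
    simp only [min_eq_right h, min_eq_right h', sub_self, mul_zero]
    exact measurable_const

/-- `I` is fixed only up to a null set; the limsup of an almost surely convergent subsequence of
simple integrals is an `ℱ t`-measurable version. -/
lemma IsItoIntegral.aestronglyMeasurable (hB : IsFilteredBrownian Q ℱ B) {φ : ℝ → Ω → ℝ} {t : ℝ≥0}
    {I : Ω → ℝ} (h : IsItoIntegral Q ℱ B φ t I) : AEStronglyMeasurable[ℱ t] I Q := by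
  obtain ⟨hI, S, -, h2⟩ := h
  have hm : ∀ k, Measurable ((S k).integral B t) := fun k =>
    ((S k).measurable_integral hB t).mono (ℱ.le t) le_rfl
  obtain ⟨ns, hns, hae⟩ := (tendstoInMeasure_of_tendsto_eLpNorm two_ne_zero
    (fun k => (hm k).aestronglyMeasurable) hI h2).exists_seq_tendsto_ae
  refine ⟨fun ω => limsup (fun k => (S (ns k)).integral B t ω) atTop,
    (Measurable.limsup fun k => (S (ns k)).measurable_integral hB t).stronglyMeasurable, ?_⟩
  filter_upwards [hae] with ω hω
  exact hω.limsup_eq.symm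

/-- Times after which a simple process is integrated over `(T, s]`. -/
def clampTime (T s : ℝ≥0) (τ : ℕ → ℝ≥0) (i : ℕ) : ℝ≥0 := max T (min (τ i) s)

lemma clampTime_mono (T s : ℝ≥0) {τ : ℕ → ℝ≥0} (hτ : Monotone τ) : Monotone (clampTime T s τ) :=
  fun _ _ h => max_le_max le_rfl (min_le_min (hτ h) le_rfl)

lemma SimpleProcess.onIoc_integral_value (S : SimpleProcess ℱ) {T s : ℝ≥0} (hTs : T ≤ s) :
    onIoc T s (fun x : ℝ × Ω => ∫ ω, S.value x.1 ω ∂Q) = ∑ i ∈ Finset.range S.n,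
      onIoc (clampTime T s S.time i) (clampTime T s S.time (i + 1))
        (fun _ => ∫ ω, S.coef i ω ∂Q) := by
  ext x
  rw [onIoc_apply, Finset.sum_apply]
  simp only [onIoc_apply, S.integral_value, clampTime]
  have hTs' : (T : ℝ) ≤ s := hTs
  by_cases hx : x.1 ∈ Set.Ioc (T : ℝ) s
  · rw [Set.indicator_of_mem hx]
    refine Finset.sum_congr rfl fun i _ => ?_
    obtain ⟨h0, h1⟩ := hx
    simp only [Set.indicator, Set.mem_Ioc, NNReal.coe_min, NNReal.coe_max, max_lt_iff, le_max_iff,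
      min_lt_iff, le_min_iff]
    grind
  · rw [Set.indicator_of_notMem hx]
    refine (Finset.sum_eq_zero fun i _ => Set.indicator_of_notMem (fun h => hx ⟨?_, ?_⟩) _).symm
    · exact lt_of_le_of_lt (NNReal.coe_le_coe.2 (le_max_left _ _)) h.1
    · exact h.2.trans (NNReal.coe_le_coe.2 (max_le hTs (min_le_right _ _)))

lemma hasItoIntegral_stepIntegral (hB : IsFilteredBrownian Q ℱ B) {τ : ℕ → ℝ≥0} (hτ : Monotone τ)
    (d : ℕ → ℝ) (n : ℕ) :
    HasItoIntegral Q ℱ B (∑ i ∈ Finset.range n, onIoc (τ i) (τ (i + 1)) fun _ => d i)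
      (stepIntegral B τ d n) := by
  have : stepIntegral B τ d n = ∑ i ∈ Finset.range n,
      fun ω => d i * (B (τ (i + 1)) ω - B (τ i) ω) := by
    ext ω; rw [Finset.sum_apply]; rfl
  rw [this]
  exact HasItoIntegral.sum _ fun i _ => HasItoIntegral.elementary hB (hτ i.le_succ)
    (c := fun _ => d i) measurable_const ⟨|d i|, fun _ => le_rfl⟩

lemma integral_sq_eq_toReal_eLpNorm {α : Type*} {_ : MeasurableSpace α} {μ : Measure α} {f : α → ℝ}
    (hf : AEStronglyMeasurable f μ) : ∫ x, f x ^ 2 ∂μ = (eLpNorm f 2 μ ^ 2).toReal := by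
  rw [eLpNorm_two_sq, integral_eq_lintegral_of_nonneg_ae (ae_of_all _ fun _ => sq_nonneg _)
    (hf.pow 2)]
  congr 1
  refine lintegral_congr fun x => ?_
  rw [← Real.enorm_of_nonneg (sq_nonneg _), enorm_pow]

/-- The Wiener integral over `(T, s]` is centred Gaussian and independent of `ℱ T`. -/
lemma map_restrict_sub_isItoIntegral (hB : IsFilteredBrownian Q ℱ B) {f : ℝ → ℝ}
    (hf : Measurable f) {T s : ℝ≥0} (hTs : T ≤ s) {I J : Ω → ℝ}
    (hI : IsItoIntegral Q ℱ B (fun u _ => f u) s I)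
    (hJ : IsItoIntegral Q ℱ B (fun u _ => f u) T J) {A : Set Ω} (hA : MeasurableSet[ℱ T] A) :
    (Q.restrict A).map (I - J) = Q A • gaussianReal 0 (∫ u in (T : ℝ)..s, f u ^ 2).toNNReal := by
  have hfm : ∀ t : ℝ≥0, AEStronglyMeasurable (Function.uncurry fun u (_ : Ω) => f u)
      ((volume.restrict (Set.Ioc (0 : ℝ) t)).prod Q) := fun t =>
    (hf.comp measurable_fst).aestronglyMeasurable
  have hR : HasItoIntegral Q ℱ B (onIoc T s fun x => f x.1) (I - J) := by
    have h := (hI.hasItoIntegral hB (hfm s)).sub (hJ.hasItoIntegral hB (hfm T))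
    rw [onIoc_sub_onIoc zero_le hTs] at h
    exact h
  have hRm : MemLp (I - J) 2 Q := hR.2.1
  have hvar : ∫ ω, (I - J) ω ^ 2 ∂Q = ∫ u in (T : ℝ)..s, f u ^ 2 := by
    have h1 := hR.eLpNorm_eq hB
    rw [eLpNorm_onIoc] at h1
    have hfm' : AEStronglyMeasurable (fun x : ℝ × Ω => f x.1)
      ((volume.restrict (Set.Ioc (T : ℝ) s)).prod Q) :=
      (hf.comp measurable_fst).aestronglyMeasurable
    rw [integral_sq_eq_toReal_eLpNorm hRm.aestronglyMeasurable, h1,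
      ← integral_sq_eq_toReal_eLpNorm hfm', integral_fun_fst (fun u => f u ^ 2),
      intervalIntegral.integral_of_le (NNReal.coe_le_coe.2 hTs)]
    simp
  rw [← hvar]
  obtain ⟨-, S, hS, -⟩ := hI
  -- The approximants of the deterministic `f` may have random coefficients. Their means give step
  -- functions, which by `eLpNorm_integral_le` are no farther from `f` in `L²`.
  refine map_restrict_of_tendsto_stepIntegral hB
    (τ := fun k => clampTime T s (S k).time) (fun k => clampTime_mono T s (S k).time_mono)
    (fun k => le_max_left _ _) (fun k i => ∫ ω, (S k).coef i ω ∂Q) (fun k => (S k).n) hRm ?_ hA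
  refine tendsto_of_tendsto_of_tendsto_of_le_of_le tendsto_const_nhds hS (fun _ => zero_le)
    fun k => ?_
  have h1 := hasItoIntegral_stepIntegral hB (clampTime_mono T s (S k).time_mono)
    (fun i => ∫ ω, (S k).coef i ω ∂Q) (S k).n
  rw [← (S k).onIoc_integral_value hTs] at h1
  have h2 := (h1.sub hR).eLpNorm_eq hB
  rw [← onIoc_sub, eLpNorm_onIoc] at h2
  rw [h2]
  have hgm : Measurable (fun x : ℝ × Ω => (S k).value x.1 x.2 - f x.1) :=
    (S k).measurable_value.sub (hf.comp measurable_fst)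
  have h3 := eLpNorm_integral_le (Q := Q) (μ := volume.restrict (Set.Ioc (T : ℝ) s))
    hgm.aestronglyMeasurable
  refine le_trans (le_of_eq ?_) (h3.trans (eLpNorm_mono_measure _ ?_))
  · congr 1
    ext x
    simp only [Pi.sub_apply]
    rw [integral_sub ((S k).integrable_value _) (integrable_const _)]
    simp
  · exact Measure.prod_mono
      (Measure.restrict_mono (Set.Ioc_subset_Ioc_left T.coe_nonneg) le_rfl) le_rfl

end WienerIto

/-! ### The forward variance `E[V_s | ℱ T]` -/

section ForwardVariance

lemma measurable_kernel (H t : ℝ) : Measurable (kernel H t) := by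
  unfold kernel
  fun_prop

lemma integral_kernel_sq {H : ℝ} (hH : 0 < H) {r t : ℝ} (hrt : r ≤ t) :
    ∫ u in r..t, kernel H t u ^ 2 = (t - r) ^ (2 * H) / (2 * H) := by
  have h1 : ∫ u in r..t, kernel H t u ^ 2 = ∫ u in r..t, (t - u) ^ (2 * H - 1) := by
    refine intervalIntegral.integral_congr fun u hu => ?_
    rw [Set.uIcc_of_le hrt] at hu
    have h0 : 0 ≤ t - u := sub_nonneg.2 hu.2
    simp only [kernel]
    rw [← Real.rpow_natCast, ← Real.rpow_mul h0]
    congr 1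
    push_cast
    ring
  rw [h1, intervalIntegral.integral_comp_sub_left (fun x => x ^ (2 * H - 1)), sub_self,
    integral_rpow (Or.inl (by linarith)), sub_add_cancel, Real.zero_rpow (by positivity), sub_zero]

lemma volterraBracket_eq {H : ℝ} (hH : 0 < H) {t : ℝ} (ht : 0 ≤ t) :
    volterraBracket H t = t ^ (2 * H) / (2 * H) := by
  rw [volterraBracket, integral_kernel_sq hH ht, sub_zero]

variable {Ω : Type*} {mΩ : MeasurableSpace Ω} {Q : Measure Ω} [IsProbabilityMeasure Q]
  {ℱ : Filtration ℝ≥0 mΩ} {H ν ρ : ℝ} {W Z : ℝ≥0 → Ω → ℝ} {ξ₀ 𝒱 : ℝ → Ω → ℝ} {X : ℝ≥0 → Ω → ℝ}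

/-- The conditional expectation given `ℱ T` of the instantaneous variance at a later time. -/
lemma IsModel.condExp_instVariance (hM : IsModel Q ℱ H ν ρ W Z ξ₀ 𝒱 X) {T s : ℝ≥0} (hTs : T ≤ s)
    {𝒱T : ℝ → Ω → ℝ} (h𝒱T : IsTruncatedVolterra Q ℱ H Z T 𝒱T)
    (hi : Integrable (instVariance H ν ξ₀ 𝒱 s) Q) :
    Q[instVariance H ν ξ₀ 𝒱 s|ℱ T] =ᵐ[Q] fun ω => ξ₀ s ω * eta H ν 𝒱T s ω *
      Real.exp (ν ^ 2 * cH H ^ 2 / H * (((s : ℝ) - T) ^ (2 * H) - (s : ℝ) ^ (2 * H))) := by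
  have hB := hM.brownian_Z
  have hH := hM.H_pos
  have hTs' : (T : ℝ) ≤ s := hTs
  have hI := hM.volterra s
  have hJ := h𝒱T.integral s hTs'
  have hJm := hJ.aestronglyMeasurable hB
  obtain ⟨hei, hce⟩ := condExp_exp_mul_of_map_restrict (ℱ.le T)
    (hI.1.sub hJ.1).aemeasurable
    (fun A hA => map_restrict_sub_isItoIntegral hB (measurable_kernel H s) hTs hI hJ hA)
    (2 * ν * cH H)
  set c := 2 * ν * cH H with hc
  -- `P` is the `ℱ T`-measurable factor of `V_s`; the other is the exponential of `c` times the
  -- Wiener integral over `(T, s]`.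
  set P : Ω → ℝ := fun ω => ξ₀ s ω * Real.exp (c * 𝒱T s ω - c ^ 2 * volterraBracket H s / 2) with hP
  have hPm : AEStronglyMeasurable[ℱ T] P Q := by
    have h1 : Measurable[ℱ 0] (ξ₀ s) := by
      exact @Measurable.of_uncurry_left _ _ _ _ (ℱ 0) _ _ hM.ξ₀_measurable _
    have h2 : AEStronglyMeasurable[ℱ T] (ξ₀ s) Q :=
      (h1.mono (ℱ.mono zero_le) le_rfl).stronglyMeasurable.aestronglyMeasurable
    have hcont : Continuous fun x : ℝ => Real.exp (c * x - c ^ 2 * volterraBracket H s / 2) := by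
      fun_prop
    exact h2.mul (hcont.comp_aestronglyMeasurable hJm)
  have hV : instVariance H ν ξ₀ 𝒱 s = P * fun ω => Real.exp (c * (𝒱 s - 𝒱T s) ω) := by
    ext ω
    simp only [instVariance, hP, Pi.mul_apply, Pi.sub_apply, ← hc]
    rw [mul_assoc (ξ₀ s ω), ← Real.exp_add]
    congr 2
    ring
  rw [hV] at hi ⊢
  have hpull := condExp_mul_of_aestronglyMeasurable_left hPm hi hei
  filter_upwards [hpull, hce] with ω h1 h2
  rw [h1, Pi.mul_apply, h2]
  simp only [hP, eta, ← hc]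
  have hv0 : 0 ≤ ((s : ℝ) - T) ^ (2 * H) / (2 * H) :=
    div_nonneg (Real.rpow_nonneg (sub_nonneg.2 hTs') _) (by positivity)
  rw [integral_kernel_sq hH hTs', Real.coe_toNNReal _ hv0, volterraBracket_eq hH s.coe_nonneg,
    mul_assoc (ξ₀ s ω), mul_assoc (ξ₀ s ω), ← Real.exp_add, ← Real.exp_add, hc]
  -- With `c = 2 ν C_H`, both exponents carry the constant `c² / (4H) = ν² C_H² / H`.
  congr 2
  field_simp
  ring

end ForwardVariance

/-! ### Fine partitions that refine a finite set -/

section Partition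

/-- A partition of `[0, t]` of mesh at most `δ` with no point of a given finite set in the interior
of a cell. -/
lemma exists_partition (F : Finset ℝ≥0) (t : ℝ≥0) {δ : ℝ≥0} (hδ : 0 < δ) :
    ∃ (N : ℕ) (p : ℕ → ℝ≥0), Monotone p ∧ p 0 = 0 ∧ p N = t ∧
      (∀ i < N, p (i + 1) ≤ p i + δ) ∧ ∀ i < N, ∀ x ∈ F, x ≤ p i ∨ p (i + 1) ≤ x := by
  classical
  set L := ⌊t / δ⌋₊ + 1 with hL
  -- The partition enumerates `G` in increasing order. The multiples of `δ` bound the mesh, and `L`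
  -- is large enough for them to pass `t`.
  set G : Finset ℝ≥0 := insert 0 (insert t
    (F.image (fun x => min x t) ∪ (Finset.range (L + 1)).image fun l : ℕ => min (l * δ) t)) with hG
  have h0 : (0 : ℝ≥0) ∈ G := by simp [hG]
  have ht : t ∈ G := by simp [hG]
  have hle : ∀ x ∈ G, x ≤ t := by
    intro x hx
    simp only [hG, Finset.mem_insert, Finset.mem_union, Finset.mem_image] at hx
    rcases hx with rfl | rfl | ⟨y, -, rfl⟩ | ⟨y, -, rfl⟩
    · exact zero_le
    · exact le_rfl
    · exact min_le_right _ _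
    · exact min_le_right _ _
  have hpos : 0 < G.card := Finset.card_pos.2 ⟨0, h0⟩
  set e := G.orderEmbOfFin rfl with he
  have hemem : ∀ i, e i ∈ G := fun i => Finset.orderEmbOfFin_mem G rfl i
  have hesurj : ∀ x ∈ G, ∃ i, e i = x := by
    intro x hx
    have : x ∈ Set.range e := by rw [he, Finset.range_orderEmbOfFin]; exact hx
    exact this
  set p : ℕ → ℝ≥0 := fun i => if h : i < G.card then e ⟨i, h⟩ else t with hp
  have hplt : ∀ {i} (h : i < G.card), p i = e ⟨i, h⟩ := fun h => by simp [hp, h]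
  have hpt : ∀ i, p i ≤ t := by
    intro i
    by_cases h : i < G.card
    · rw [hplt h]; exact hle _ (hemem _)
    · simp [hp, h]
  -- No point of `G` lies strictly between consecutive ones; both the mesh bound and the refinement
  -- follow from this.
  have key : ∀ i < G.card - 1, ∀ x ∈ G, x ≤ p i ∨ p (i + 1) ≤ x := by
    intro i hi x hx
    obtain ⟨j, rfl⟩ := hesurj x hx
    rw [hplt (i := i) (by omega), hplt (i := i + 1) (by omega), e.le_iff_le, e.le_iff_le,
      Fin.le_def, Fin.le_def]
    simp only
    omega
  refine ⟨G.card - 1, p, monotone_nat_of_le_succ fun i => ?_, ?_, ?_, fun i hi => ?_,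
    fun i hi x hx => ?_⟩
  · by_cases h : i + 1 < G.card
    · rw [hplt h, hplt (Nat.lt_of_succ_lt h), e.le_iff_le, Fin.le_def]
      simp
    · have : p (i + 1) = t := by simp [hp, h]
      rw [this]; exact hpt i
  · obtain ⟨j, hj⟩ := hesurj 0 h0
    refine le_antisymm ?_ zero_le
    rw [hplt hpos, ← hj, e.le_iff_le, Fin.le_def]
    exact Nat.zero_le _
  · obtain ⟨j, hj⟩ := hesurj t ht
    refine le_antisymm (hpt _) ?_
    rw [hplt (Nat.sub_lt hpos one_pos), ← hj, e.le_iff_le, Fin.le_def]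
    have := j.2
    simp only
    omega
  · set l := ⌊p i / δ⌋₊ with hl
    have h1 : (l : ℝ≥0) * δ ≤ p i := by
      rw [← le_div_iff₀ hδ]; exact Nat.floor_le zero_le
    have h2 : p i < ((l + 1 : ℕ) : ℝ≥0) * δ := by
      rw [← div_lt_iff₀ hδ]; push_cast; exact Nat.lt_floor_add_one _
    have h3 : l + 1 < L + 1 := by
      have : l ≤ ⌊t / δ⌋₊ := Nat.floor_le_floor (div_le_div_of_nonneg_right (hpt i) zero_le)
      omega
    have h4 : min (((l + 1 : ℕ) : ℝ≥0) * δ) t ∈ G := by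
      simp only [hG, Finset.mem_insert, Finset.mem_union, Finset.mem_image]
      exact Or.inr (Or.inr (Or.inr ⟨l + 1, Finset.mem_range.2 h3, rfl⟩))
    have h5 : ((l + 1 : ℕ) : ℝ≥0) * δ ≤ p i + δ := by
      push_cast
      rw [add_mul, one_mul]
      gcongr
    rcases key i hi _ h4 with h | h
    · rcases min_le_iff.1 h with h | h
      · exact absurd h (not_le.2 h2)
      · exact (hpt _).trans (h.trans le_self_add)
    · exact h.trans ((min_le_left _ _).trans h5)
  · have hx' : min x t ∈ G := by
      simp only [hG, Finset.mem_insert, Finset.mem_union, Finset.mem_image]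
      exact Or.inr (Or.inr (Or.inl ⟨x, hx, rfl⟩))
    rcases key i hi _ hx' with h | h
    · rcases le_total x t with hxt | hxt
      · left; rwa [min_eq_left hxt] at h
      · right; exact (hpt _).trans hxt
    · right; exact h.trans (min_le_left _ _)

end Partition

/-! ### Quadratic variation of simple integrals -/

section SimpleQuadraticVariation

variable {Ω : Type*} {mΩ : MeasurableSpace Ω} {Q : Measure Ω} [IsProbabilityMeasure Q]
  {ℱ : Filtration ℝ≥0 mΩ} {B : ℝ≥0 → Ω → ℝ}

lemma IsFilteredBrownian.memLp_sq_increment_sub (hB : IsFilteredBrownian Q ℱ B) {s t : ℝ≥0}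
    (hst : s ≤ t) (v : ℝ) : MemLp (fun ω => (B t ω - B s ω) ^ 2 - v) 2 Q := by
  have h4 := hB.memLp_increment hst (p := 4) ENNReal.ofNat_ne_top
  have : ENNReal.HolderTriple 4 4 2 := ⟨by
    rw [← ENNReal.toReal_eq_toReal_iff' (by simp) (by simp), ENNReal.toReal_add (by simp) (by simp)]
    norm_num⟩
  have h2 := h4.mul' (r := 2) h4
  simp only [← sq] at h2
  exact h2.sub (memLp_const v)

/-- The summands are martingale differences, hence orthogonal, and each has second moment of the
order of the squared cell length. The bound therefore vanishes with the mesh. -/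
lemma integral_sq_sum_sq_increments_le (hB : IsFilteredBrownian Q ℱ B) {p : ℕ → ℝ≥0}
    (hp : Monotone p) {c : ℕ → Ω → ℝ} (hc : ∀ i, Measurable[ℱ (p i)] (c i)) {C : ℝ}
    (hC : ∀ i ω, |c i ω| ≤ C) (n : ℕ) :
    MemLp (fun ω => ∑ i ∈ Finset.range n,
      c i ω ^ 2 * ((B (p (i + 1)) ω - B (p i) ω) ^ 2 - ((p (i + 1) : ℝ) - p i))) 2 Q ∧
    ∫ ω, (∑ i ∈ Finset.range n,
      c i ω ^ 2 * ((B (p (i + 1)) ω - B (p i) ω) ^ 2 - ((p (i + 1) : ℝ) - p i))) ^ 2 ∂Q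
    ≤ C ^ 4 * gaussianSqVar * ∑ i ∈ Finset.range n, ((p (i + 1) : ℝ) - p i) ^ 2 := by
  have hcm : ∀ i, Measurable (c i) := fun i => (hc i).mono (ℱ.le _) le_rfl
  have hD : ∀ i, MemLp (fun ω =>
      c i ω ^ 2 * ((B (p (i + 1)) ω - B (p i) ω) ^ 2 - ((p (i + 1) : ℝ) - p i))) 2 Q := by
    intro i
    refine (hB.memLp_sq_increment_sub (hp i.le_succ) _).mul' (p := ⊤)
      (memLp_top_of_bound ((hcm i).pow_const 2).aestronglyMeasurable (C ^ 2) (ae_of_all _ fun ω => ?_))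
    rw [norm_pow]
    exact pow_le_pow_left₀ (norm_nonneg _) (hC i ω) 2
  induction n with
  | zero => simp
  | succ n ih =>
    obtain ⟨ih1, ih2⟩ := ih
    set Y : Ω → ℝ := fun ω => ∑ i ∈ Finset.range n,
      c i ω ^ 2 * ((B (p (i + 1)) ω - B (p i) ω) ^ 2 - ((p (i + 1) : ℝ) - p i)) with hY
    set D : Ω → ℝ := fun ω =>
      c n ω ^ 2 * ((B (p (n + 1)) ω - B (p n) ω) ^ 2 - ((p (n + 1) : ℝ) - p n)) with hDn
    have hpn : p n ≤ p (n + 1) := hp n.le_succ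
    have hsub : ((p (n + 1) - p n : ℝ≥0) : ℝ) = (p (n + 1) : ℝ) - p n := NNReal.coe_sub hpn
    have hYm : Measurable[ℱ (p n)] Y := by
      apply Finset.measurable_sum
      intro i hi
      have hi := Finset.mem_range.1 hi
      have m1 : Measurable[ℱ (p n)] (c i) := (hc i).mono (ℱ.mono (hp hi.le)) le_rfl
      have m2 : Measurable[ℱ (p n)] (B (p (i + 1))) := (hB.adapted _).mono (ℱ.mono (hp hi)) le_rfl
      have m3 : Measurable[ℱ (p n)] (B (p i)) := (hB.adapted _).mono (ℱ.mono (hp hi.le)) le_rfl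
      exact (m1.pow_const 2).mul (((m2.sub m3).pow_const 2).sub_const _)
    have hcross : ∫ ω, Y ω * D ω ∂Q = 0 := by
      have h := hB.integral_mul_comp_increment hpn (hYm.mul ((hc n).pow_const 2))
        (g := fun x => x ^ 2 - ((p (n + 1) : ℝ) - p n)) (by fun_prop)
      have h0 : ∫ x, x ^ 2 - ((p (n + 1) : ℝ) - p n) ∂(gaussianReal 0 (p (n + 1) - p n)) = 0 := by
        have hx : Integrable (fun x : ℝ => x ^ 2) (gaussianReal 0 (p (n + 1) - p n)) :=
          (memLp_id_gaussianReal 2).integrable_sq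
        rw [integral_sub hx (integrable_const _),
          integral_sq_gaussianReal, hsub]
        simp
      rw [h0, mul_zero] at h
      rw [← h]
      congr 1 with ω
      simp only [hDn, Pi.mul_apply]
      ring
    have hsq : ∫ ω, D ω ^ 2 ∂Q ≤ C ^ 4 * gaussianSqVar * ((p (n + 1) : ℝ) - p n) ^ 2 := by
      have h := hB.integral_mul_comp_increment hpn ((hc n).pow_const 4)
        (g := fun x => (x ^ 2 - ((p (n + 1) - p n : ℝ≥0) : ℝ)) ^ 2) (by fun_prop)
      rw [integral_sq_sub_sq_gaussianReal] at h
      have h2 : ∫ ω, D ω ^ 2 ∂Q = ∫ ω, c n ω ^ 4 *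
          ((B (p (n + 1)) ω - B (p n) ω) ^ 2 - ((p (n + 1) - p n : ℝ≥0) : ℝ)) ^ 2 ∂Q := by
        congr 1 with ω
        simp only [hDn, hsub]
        ring
      have hb : ∀ ω, ‖c n ω ^ 4‖ ≤ C ^ 4 := fun ω => by
        rw [norm_pow]
        exact pow_le_pow_left₀ (norm_nonneg _) (hC n ω) 4
      have h3 : ∫ ω, c n ω ^ 4 ∂Q ≤ C ^ 4 := by
        have h4 := norm_integral_le_of_norm_le_const (μ := Q) (ae_of_all _ hb)
        simp only [probReal_univ, mul_one] at h4
        exact (Real.le_norm_self _).trans h4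
      rw [h2, h, hsub, mul_assoc, mul_comm gaussianSqVar]
      exact mul_le_mul_of_nonneg_right h3 (mul_nonneg (sq_nonneg _) gaussianSqVar_nonneg)
    have hsum : ∀ ω, ∑ i ∈ Finset.range (n + 1),
        c i ω ^ 2 * ((B (p (i + 1)) ω - B (p i) ω) ^ 2 - ((p (i + 1) : ℝ) - p i)) = Y ω + D ω :=
      fun ω => Finset.sum_range_succ _ _
    simp_rw [hsum]
    refine ⟨ih1.add (hD n), ?_⟩
    have hexp : ∫ ω, (Y ω + D ω) ^ 2 ∂Q
        = ∫ ω, Y ω ^ 2 ∂Q + 2 * ∫ ω, Y ω * D ω ∂Q + ∫ ω, D ω ^ 2 ∂Q := by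
      have i1 : Integrable (fun ω => Y ω ^ 2) Q := ih1.integrable_sq
      have i2 : Integrable (fun ω => 2 * (Y ω * D ω)) Q := (ih1.integrable_mul (hD n)).const_mul 2
      have i3 : Integrable (fun ω => D ω ^ 2) Q := (hD n).integrable_sq
      have i12 : Integrable (fun ω => Y ω ^ 2 + 2 * (Y ω * D ω)) Q := i1.add i2
      rw [← integral_const_mul, ← integral_add i1 i2, ← integral_add i12 i3]
      congr 1 with ω
      ring
    rw [hexp, hcross, Finset.sum_range_succ, mul_add]
    linarith

/-- The value of a simple process on a cell `(a, b]` that contains none of its jump times. -/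
noncomputable def SimpleProcess.cellValue (S : SimpleProcess ℱ) (a b : ℝ≥0) (ω : Ω) : ℝ :=
  ∑ j ∈ Finset.range S.n, if S.time j ≤ a ∧ b ≤ S.time (j + 1) then S.coef j ω else 0

lemma SimpleProcess.measurable_cellValue (S : SimpleProcess ℱ) (a b : ℝ≥0) :
    Measurable[ℱ a] (S.cellValue a b) := by
  unfold SimpleProcess.cellValue
  apply Finset.measurable_sum
  intro j _
  by_cases h : S.time j ≤ a ∧ b ≤ S.time (j + 1)
  · simp only [h, and_self, if_true]
    exact (S.coef_measurable j).mono (ℱ.mono h.1) le_rfl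
  · simp only [h, if_false]
    exact measurable_const

lemma SimpleProcess.exists_bound_cellValue (S : SimpleProcess ℱ) :
    ∃ C : ℝ, 0 ≤ C ∧ ∀ a b ω, |S.cellValue a b ω| ≤ C := by
  obtain ⟨C, hC⟩ := S.coef_bounded
  refine ⟨S.n * |C|, by positivity, fun a b ω => ?_⟩
  refine (Finset.abs_sum_le_sum_abs _ _).trans ?_
  refine (Finset.sum_le_card_nsmul _ _ |C| fun j _ => ?_).trans (by simp)
  split_ifs
  · exact (hC j ω).trans (le_abs_self C)
  · simp

/-- The hypothesis runs over `j ≤ S.n` because the right end of the last interval is also a jump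
time. -/
lemma SimpleProcess.integral_sub_integral (S : SimpleProcess ℱ) {a b : ℝ≥0} (hab : a ≤ b)
    (h : ∀ j ≤ S.n, S.time j ≤ a ∨ b ≤ S.time j) (ω : Ω) :
    S.integral B b ω - S.integral B a ω = S.cellValue a b ω * (B b ω - B a ω) := by
  unfold SimpleProcess.integral SimpleProcess.cellValue
  rw [← Finset.sum_sub_distrib, Finset.sum_mul]
  refine Finset.sum_congr rfl fun j hj => ?_
  have hj := Finset.mem_range.1 hj
  have hm : S.time j ≤ S.time (j + 1) := S.time_mono j.le_succ
  rcases h j hj.le with h1 | h1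
  · rcases h (j + 1) hj with h2 | h2
    · have h1b := h1.trans hab
      have h2b := h2.trans hab
      rw [min_eq_left h1, min_eq_left h2, min_eq_left h1b, min_eq_left h2b, sub_self]
      -- The condition of `cellValue` can hold here only on an empty cell, where the Brownian
      -- increment is zero.
      split_ifs with h3
      · have : a = b := le_antisymm hab (h3.2.trans h2)
        simp [this]
      · simp
    · rw [if_pos ⟨h1, h2⟩, min_eq_left h1, min_eq_left (h1.trans hab), min_eq_right h2,
        min_eq_right (hab.trans h2)]
      ring
  · have h2 := h1.trans hm
    rw [min_eq_right h1, min_eq_right h2, min_eq_right (hab.trans h1), min_eq_right (hab.trans h2),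
      sub_self, sub_self]
    split_ifs with h3
    · have : a = b := le_antisymm hab (h1.trans h3.1)
      simp [this]
    · simp

lemma SimpleProcess.value_eq_cellValue (S : SimpleProcess ℱ) {a b : ℝ≥0}
    (h : ∀ j ≤ S.n, S.time j ≤ a ∨ b ≤ S.time j) {u : ℝ} (hu : u ∈ Set.Ioc (a : ℝ) b) (ω : Ω) :
    S.value u ω = S.cellValue a b ω := by
  unfold SimpleProcess.value SimpleProcess.cellValue
  refine Finset.sum_congr rfl fun j hj => ?_
  have hj := Finset.mem_range.1 hj
  obtain ⟨hu1, hu2⟩ := hu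
  have h1 := h j hj.le
  have h2 := h (j + 1) hj
  simp only [Set.indicator, Set.mem_Ioc, ← NNReal.coe_le_coe] at *
  grind

lemma SimpleProcess.integral_value_sq (S : SimpleProcess ℱ) {p : ℕ → ℝ≥0} (hp : Monotone p)
    (hp0 : p 0 = 0) {n : ℕ} (h : ∀ i < n, ∀ j ≤ S.n, S.time j ≤ p i ∨ p (i + 1) ≤ S.time j)
    (ω : Ω) :
    ∫ u in Set.Ioc (0 : ℝ) (p n), S.value u ω ^ 2 = ∑ i ∈ Finset.range n,
      S.cellValue (p i) (p (i + 1)) ω ^ 2 * ((p (i + 1) : ℝ) - p i) := by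
  have hcell : ∀ i < n, Set.EqOn (fun u => S.value u ω ^ 2)
      (fun _ => S.cellValue (p i) (p (i + 1)) ω ^ 2) (Set.uIoc (p i : ℝ) (p (i + 1))) := by
    intro i hi u hu
    rw [Set.uIoc_of_le (NNReal.coe_le_coe.2 (hp i.le_succ))] at hu
    simp only [S.value_eq_cellValue (h i hi) hu ω]
  have h1 := intervalIntegral.sum_integral_adjacent_intervals (μ := volume)
    (f := fun u => S.value u ω ^ 2) (a := fun i => (p i : ℝ)) (n := n) fun i hi =>
      (intervalIntegrable_const (c := S.cellValue (p i) (p (i + 1)) ω ^ 2)).congr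
        (hcell i hi).symm
  rw [← intervalIntegral.integral_of_le (p n).coe_nonneg]
  simp only [hp0, NNReal.coe_zero] at h1
  rw [← h1]
  refine Finset.sum_congr rfl fun i hi => ?_
  rw [intervalIntegral.integral_congr_ae (g := fun _ => S.cellValue (p i) (p (i + 1)) ω ^ 2)
    (ae_of_all _ fun u hu => hcell i (Finset.mem_range.1 hi) hu), intervalIntegral.integral_const,
    smul_eq_mul, mul_comm]

/-- Quadratic variation of the integral of a simple process along a partition that refines its
jump times. -/
lemma SimpleProcess.eLpNorm_sum_sq_sub_le (hB : IsFilteredBrownian Q ℱ B) (S : SimpleProcess ℱ)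
    {C : ℝ} (hC : ∀ a b ω, |S.cellValue a b ω| ≤ C) {p : ℕ → ℝ≥0} (hp : Monotone p)
    (hp0 : p 0 = 0) {n : ℕ} (h : ∀ i < n, ∀ j ≤ S.n, S.time j ≤ p i ∨ p (i + 1) ≤ S.time j)
    {δ : ℝ≥0} (hδ : ∀ i < n, p (i + 1) ≤ p i + δ) :
    eLpNorm (fun ω => (∑ i ∈ Finset.range n,
      (S.integral B (p (i + 1)) ω - S.integral B (p i) ω) ^ 2)
        - ∫ u in Set.Ioc (0 : ℝ) (p n), S.value u ω ^ 2) 2 Q ^ 2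
      ≤ ENNReal.ofReal (C ^ 4 * gaussianSqVar * (δ * p n)) := by
  have he : ∀ ω, (∑ i ∈ Finset.range n,
      (S.integral B (p (i + 1)) ω - S.integral B (p i) ω) ^ 2)
        - ∫ u in Set.Ioc (0 : ℝ) (p n), S.value u ω ^ 2
      = ∑ i ∈ Finset.range n, S.cellValue (p i) (p (i + 1)) ω ^ 2 *
        ((B (p (i + 1)) ω - B (p i) ω) ^ 2 - ((p (i + 1) : ℝ) - p i)) := by
    intro ω
    rw [S.integral_value_sq hp hp0 h ω, ← Finset.sum_sub_distrib]
    refine Finset.sum_congr rfl fun i hi => ?_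
    rw [S.integral_sub_integral (hp i.le_succ) (h i (Finset.mem_range.1 hi))]
    ring
  simp_rw [he]
  obtain ⟨h1, h2⟩ := integral_sq_sum_sq_increments_le hB hp
    (fun i => S.measurable_cellValue (p i) (p (i + 1))) (fun i ω => hC _ _ ω) n
  rw [integral_sq_eq_toReal_eLpNorm h1.aestronglyMeasurable] at h2
  rw [← ENNReal.ofReal_toReal (ENNReal.pow_ne_top h1.eLpNorm_ne_top)]
  refine ENNReal.ofReal_le_ofReal (h2.trans ?_)
  have hC0 : 0 ≤ C ^ 4 := by positivity
  refine mul_le_mul_of_nonneg_left ?_ (mul_nonneg hC0 gaussianSqVar_nonneg)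
  have h3 : ∑ i ∈ Finset.range n, ((p (i + 1) : ℝ) - p i) = p n := by
    rw [Finset.sum_range_sub (fun i => (p i : ℝ)), hp0]
    simp
  rw [← h3, Finset.mul_sum]
  refine Finset.sum_le_sum fun i hi => ?_
  have h4 : (p i : ℝ) ≤ p (i + 1) := hp i.le_succ
  have h5 : (p (i + 1) : ℝ) ≤ p i + δ := hδ i (Finset.mem_range.1 hi)
  rw [sq]
  exact mul_le_mul_of_nonneg_right (by linarith) (by linarith)

end SimpleQuadraticVariation

/-! ### Deterministic estimates along a path -/

section Pathwise

lemma abs_sqrt_sum_sq_sub_le (n : ℕ) (x y : ℕ → ℝ) :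
    |√(∑ i ∈ Finset.range n, x i ^ 2) - √(∑ i ∈ Finset.range n, y i ^ 2)|
      ≤ √(∑ i ∈ Finset.range n, (x i - y i) ^ 2) := by
  have h := abs_norm_sub_norm_le (WithLp.toLp 2 fun i : Fin n => x i : EuclideanSpace ℝ (Fin n))
    (WithLp.toLp 2 fun i : Fin n => y i)
  simp only [EuclideanSpace.norm_eq, Real.norm_eq_abs, sq_abs, PiLp.sub_apply] at h
  simpa only [Finset.sum_range] using h

lemma abs_sqrt_integral_sq_sub_le {α : Type*} {_ : MeasurableSpace α} {μ : Measure α} {f g : α → ℝ}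
    (hf : MemLp f 2 μ) (hg : MemLp g 2 μ) :
    |√(∫ x, f x ^ 2 ∂μ) - √(∫ x, g x ^ 2 ∂μ)| ≤ √(∫ x, (f x - g x) ^ 2 ∂μ) := by
  have key : ∀ {k : α → ℝ} (hk : MemLp k 2 μ), √(∫ x, k x ^ 2 ∂μ) = ‖hk.toLp k‖ := by
    intro k hk
    rw [integral_sq_eq_toReal_eLpNorm hk.aestronglyMeasurable, Lp.norm_toLp, ENNReal.toReal_pow,
      Real.sqrt_sq ENNReal.toReal_nonneg]
  have h := abs_norm_sub_norm_le (hf.toLp f) (hg.toLp g)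
  rw [← MemLp.toLp_sub hf hg, ← key, ← key, ← key] at h
  exact h

/-- For use with `x`, `y` the sums of squared increments of `X` and of `∫ S_k dB`, `z = ∫ S_k²` and
`L = ∫ V`. The outer comparisons are reverse triangle inequalities, hence between square roots; the
middle one comes from a variance bound. -/
lemma tendsto_of_abs_sqrt_sub_le {x y z ε ε' : ℕ → ℝ} {L : ℝ} (hx : ∀ k, 0 ≤ x k)
    (hz : ∀ k, 0 ≤ z k) (hL : 0 ≤ L)
    (h1 : ∀ k, |√(x k) - √(y k)| ≤ √(ε k)) (hε : Tendsto ε atTop (𝓝 0))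
    (h2 : Tendsto (fun k => y k - z k) atTop (𝓝 0))
    (h3 : ∀ k, |√(z k) - √L| ≤ √(ε' k)) (hε' : Tendsto ε' atTop (𝓝 0)) :
    Tendsto x atTop (𝓝 L) := by
  have sq0 : ∀ {e : ℕ → ℝ}, Tendsto e atTop (𝓝 0) → Tendsto (fun k => √(e k)) atTop (𝓝 0) := by
    intro e he
    simpa using he.sqrt
  have z1 : Tendsto (fun k => √(z k)) atTop (𝓝 (√L)) := by
    rw [tendsto_iff_norm_sub_tendsto_zero]
    exact squeeze_zero (fun _ => norm_nonneg _) h3 (sq0 hε')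
  have z2 : Tendsto z atTop (𝓝 L) := by
    have := z1.pow 2
    rw [Real.sq_sqrt hL] at this
    exact this.congr fun k => Real.sq_sqrt (hz k)
  have y1 : Tendsto y atTop (𝓝 L) := by
    have := h2.add z2
    simpa using this
  have x1 : Tendsto (fun k => √(x k)) atTop (𝓝 (√L)) := by
    have h4 : Tendsto (fun k => √(x k) - √(y k)) atTop (𝓝 0) := by
      rw [tendsto_zero_iff_norm_tendsto_zero]
      exact squeeze_zero (fun _ => norm_nonneg _) h1 (sq0 hε)
    have := h4.add y1.sqrt
    simpa using this
  have := x1.pow 2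
  rw [Real.sq_sqrt hL] at this
  exact this.congr fun k => Real.sq_sqrt (hx k)

/-- Continuous monotone functions have zero quadratic variation. -/
lemma tendsto_sum_sq_increments_of_monotoneOn {A : ℝ → ℝ} {t : ℝ≥0}
    (hc : ContinuousOn A (Set.Icc 0 t)) (hm : MonotoneOn A (Set.Icc 0 t))
    {N : ℕ → ℕ} {p : ℕ → ℕ → ℝ≥0} (hp : ∀ k, Monotone (p k)) (hp0 : ∀ k, p k 0 = 0)
    (hpN : ∀ k, p k (N k) = t)
    (hmesh : ∀ δ : ℝ≥0, 0 < δ → ∀ᶠ k in atTop, ∀ i < N k, p k (i + 1) ≤ p k i + δ) :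
    Tendsto (fun k => ∑ i ∈ Finset.range (N k), (A (p k (i + 1)) - A (p k i)) ^ 2) atTop (𝓝 0) := by
  have hmem : ∀ k, ∀ i ≤ N k, (p k i : ℝ) ∈ Set.Icc (0 : ℝ) t := fun k i hi =>
    ⟨NNReal.coe_nonneg _, by rw [← hpN k]; exact hp k hi⟩
  have hA : 0 ≤ A t - A 0 := sub_nonneg.2 (hm ⟨le_rfl, t.coe_nonneg⟩ ⟨t.coe_nonneg, le_rfl⟩
    t.coe_nonneg)
  have huc := isCompact_Icc.uniformContinuousOn_of_continuous hc
  rw [Metric.uniformContinuousOn_iff_le] at huc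
  rw [Metric.tendsto_atTop']
  intro ε hε
  -- The sum is at most the largest increment times `A t - A 0`; the `+ 1` covers a constant `A`.
  obtain ⟨δ, hδ, hd⟩ := huc (ε / (2 * (A t - A 0 + 1))) (by positivity)
  have hev := hmesh ⟨δ, hδ.le⟩ hδ
  rw [eventually_atTop] at hev
  obtain ⟨K, hK⟩ := hev
  refine ⟨K, fun k hk => ?_⟩
  have hstep : ∀ i ∈ Finset.range (N k), (A (p k (i + 1)) - A (p k i)) ^ 2
      ≤ ε / (2 * (A t - A 0 + 1)) * (A (p k (i + 1)) - A (p k i)) := by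
    intro i hi
    have hi := Finset.mem_range.1 hi
    have hle : (p k i : ℝ) ≤ p k (i + 1) := hp k i.le_succ
    have h0 : 0 ≤ A (p k (i + 1)) - A (p k i) :=
      sub_nonneg.2 (hm (hmem k i hi.le) (hmem k (i + 1) hi) hle)
    have h1 : (p k (i + 1) : ℝ) ≤ p k i + δ := hK k hk.le i hi
    have h2 := hd _ (hmem k (i + 1) hi) _ (hmem k i hi.le) (by
      rw [Real.dist_eq, abs_of_nonneg (by linarith)]; linarith)
    rw [Real.dist_eq, abs_of_nonneg h0] at h2
    rw [sq]
    exact mul_le_mul_of_nonneg_right h2 h0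
  have hsum := Finset.sum_le_sum hstep
  rw [← Finset.mul_sum, Finset.sum_range_sub (fun i => A (p k i)), hp0, hpN, NNReal.coe_zero] at hsum
  rw [Real.dist_eq, sub_zero, abs_of_nonneg (Finset.sum_nonneg fun _ _ => sq_nonneg _)]
  refine hsum.trans_lt ?_
  rw [div_mul_eq_mul_div, div_lt_iff₀ (by positivity)]
  nlinarith

end Pathwise

/-! ### Quadratic variation of the log-price -/

section ItoQuadraticVariation

variable {Ω : Type*} {mΩ : MeasurableSpace Ω} {Q : Measure Ω} [IsProbabilityMeasure Q]
  {ℱ : Filtration ℝ≥0 mΩ} {B : ℝ≥0 → Ω → ℝ}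

/-- By the isometry on each cell, the expected sum does not depend on the partition of `[0, p n]`.
An `L²`-small integrand thus has small squared increments whatever the mesh. -/
lemma lintegral_sum_sq_increments (hB : IsFilteredBrownian Q ℱ B) {φ : ℝ × Ω → ℝ}
    {I : ℝ≥0 → Ω → ℝ} (hI : ∀ s, HasItoIntegral Q ℱ B (onIoc 0 s φ) (I s)) {p : ℕ → ℝ≥0}
    (hp : Monotone p) (hp0 : p 0 = 0) (n : ℕ) :
    ∑ i ∈ Finset.range n, ∫⁻ ω, ‖I (p (i + 1)) ω - I (p i) ω‖ₑ ^ 2 ∂Q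
      = eLpNorm φ 2 ((volume.restrict (Set.Ioc (0 : ℝ) (p n))).prod Q) ^ 2 := by
  induction n with
  | zero => simp [hp0]
  | succ n ih =>
    have hpn : p n ≤ p (n + 1) := hp n.le_succ
    have h1 := (hI (p (n + 1))).sub (hI (p n))
    rw [onIoc_sub_onIoc zero_le hpn] at h1
    have h2 := h1.eLpNorm_eq hB
    rw [eLpNorm_onIoc] at h2
    have h3 := eLpNorm_two_sq (I (p (n + 1)) - I (p n)) Q
    simp only [Pi.sub_apply] at h3
    rw [Finset.sum_range_succ, ih, ← h3, h2, eLpNorm_two_sq, eLpNorm_two_sq, eLpNorm_two_sq]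
    have hu : Set.Ioc (0 : ℝ) (p (n + 1)) ×ˢ (Set.univ : Set Ω)
        = Set.Ioc (0 : ℝ) (p n) ×ˢ Set.univ ∪ Set.Ioc (p n : ℝ) (p (n + 1)) ×ˢ Set.univ := by
      rw [← Set.union_prod, Set.Ioc_union_Ioc_eq_Ioc (p n).coe_nonneg (NNReal.coe_le_coe.2 hpn)]
    rw [← prod_restrict_strip, ← prod_restrict_strip, ← prod_restrict_strip, hu,
      lintegral_union (measurableSet_strip _ _)]
    refine Set.disjoint_left.2 fun x hx hx' => ?_
    exact absurd hx.1.2 (not_le.2 hx'.1.1)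

lemma tendstoInMeasure_of_lintegral {f : ℕ → Ω → ℝ} (hf : ∀ k, AEStronglyMeasurable (f k) Q)
    (h : Tendsto (fun k => ∫⁻ ω, ‖f k ω‖ₑ ∂Q) atTop (𝓝 0)) :
    TendstoInMeasure Q f atTop fun _ => 0 := by
  refine tendstoInMeasure_of_tendsto_eLpNorm one_ne_zero hf aestronglyMeasurable_const ?_
  refine h.congr fun k => ?_
  rw [eLpNorm_one_eq_lintegral_enorm]
  simp

end ItoQuadraticVariation

section ItoQuadraticVariation

variable {Ω : Type*} {mΩ : MeasurableSpace Ω} {Q : Measure Ω} [IsProbabilityMeasure Q]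
  {ℱ : Filtration ℝ≥0 mΩ} {B : ℝ≥0 → Ω → ℝ}

lemma exists_seq_tendsto_ae_of_four {f g h k : ℕ → Ω → ℝ} {f' g' h' k' : Ω → ℝ}
    (hf : TendstoInMeasure Q f atTop f') (hg : TendstoInMeasure Q g atTop g')
    (hh : TendstoInMeasure Q h atTop h') (hk : TendstoInMeasure Q k atTop k') :
    ∃ ns : ℕ → ℕ, Tendsto ns atTop atTop ∧ ∀ᵐ ω ∂Q,
      Tendsto (fun i => f (ns i) ω) atTop (𝓝 (f' ω)) ∧
      Tendsto (fun i => g (ns i) ω) atTop (𝓝 (g' ω)) ∧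
      Tendsto (fun i => h (ns i) ω) atTop (𝓝 (h' ω)) ∧
      Tendsto (fun i => k (ns i) ω) atTop (𝓝 (k' ω)) := by
  obtain ⟨a, ha, hfa⟩ := hf.exists_seq_tendsto_ae
  obtain ⟨b, hb, hgb⟩ := (hg.comp ha.tendsto_atTop).exists_seq_tendsto_ae
  have hab := ha.tendsto_atTop.comp hb.tendsto_atTop
  obtain ⟨c, hc, hhc⟩ := (hh.comp hab).exists_seq_tendsto_ae
  have habc := hab.comp hc.tendsto_atTop
  obtain ⟨d, hd, hkd⟩ := (hk.comp habc).exists_seq_tendsto_ae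
  refine ⟨_, habc.comp hd.tendsto_atTop, ?_⟩
  filter_upwards [hfa, hgb, hhc, hkd] with ω h1 h2 h3 h4
  exact ⟨h1.comp (hb.tendsto_atTop.comp (hc.tendsto_atTop.comp hd.tendsto_atTop)),
    h2.comp (hc.tendsto_atTop.comp hd.tendsto_atTop), h3.comp hd.tendsto_atTop, h4⟩

lemma SimpleProcess.memLp_value (S : SimpleProcess ℱ) (ω : Ω) {μ : Measure ℝ} [IsFiniteMeasure μ]
    (p : ℝ≥0∞) : MemLp (fun u => S.value u ω) p μ := by
  unfold SimpleProcess.value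
  exact memLp_finsetSum _ fun i _ => (memLp_const (S.coef i ω)).indicator measurableSet_Ioc

/-- Partitions adapted to a sequence of simple processes, along which the quadratic variations of
their integrals are asymptotically known. -/
lemma exists_partition_simpleProcess (hB : IsFilteredBrownian Q ℱ B) (S : ℕ → SimpleProcess ℱ)
    (t : ℝ≥0) :
    ∃ (N : ℕ → ℕ) (p : ℕ → ℕ → ℝ≥0), (∀ k, Monotone (p k)) ∧ (∀ k, p k 0 = 0) ∧
      (∀ k, p k (N k) = t) ∧
      (∀ δ : ℝ≥0, 0 < δ → ∀ᶠ k in atTop, ∀ i < N k, p k (i + 1) ≤ p k i + δ) ∧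
      TendstoInMeasure Q (fun k ω => (∑ i ∈ Finset.range (N k),
        ((S k).integral B (p k (i + 1)) ω - (S k).integral B (p k i) ω) ^ 2)
          - ∫ u in Set.Ioc (0 : ℝ) t, (S k).value u ω ^ 2) atTop fun _ => 0 := by
  choose C hC0 hC using fun k => (S k).exists_bound_cellValue
  set K : ℕ → ℝ := fun k => C k ^ 4 * gaussianSqVar * t with hK
  have hK0 : ∀ k, 0 ≤ K k := fun k =>
    mul_nonneg (mul_nonneg (pow_nonneg (hC0 k) 4) gaussianSqVar_nonneg) t.coe_nonneg
  -- This makes `K k * δ k ≤ 1 / (k + 1)²` even if the bounds `C k` blow up, and still sends the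
  -- mesh to zero.
  set δ : ℕ → ℝ≥0 := fun k => (1 / ((k : ℝ≥0) + 1)) ^ 2 / (1 + (K k).toNNReal) with hδ
  have hδ0 : ∀ k, 0 < δ k := fun k => by positivity
  choose N p hp hp0 hpN hmesh href using fun k => exists_partition
    ((Finset.range ((S k).n + 1)).image (S k).time) t (hδ0 k)
  have href' : ∀ k, ∀ i < N k, ∀ j ≤ (S k).n,
      (S k).time j ≤ p k i ∨ p k (i + 1) ≤ (S k).time j := fun k i hi j hj =>
    href k i hi _ (Finset.mem_image_of_mem _ (Finset.mem_range.2 (Nat.lt_succ_of_le hj)))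
  refine ⟨N, p, hp, hp0, hpN, fun ε hε => ?_, ?_⟩
  · have h1 : Tendsto (fun k : ℕ => (1 : ℝ≥0) / ((k : ℝ≥0) + 1)) atTop (𝓝 0) :=
      tendsto_one_div_add_atTop_nhds_zero_nat
    have h2 := h1.pow 2
    rw [zero_pow two_ne_zero] at h2
    filter_upwards [h2.eventually_lt_const hε] with k hk i hi
    refine (hmesh k i hi).trans (add_le_add le_rfl (le_trans ?_ hk.le))
    exact div_le_self zero_le (by simp)
  · have hm : ∀ k, Measurable ((fun k ω => (∑ i ∈ Finset.range (N k),
        ((S k).integral B (p k (i + 1)) ω - (S k).integral B (p k i) ω) ^ 2)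
          - ∫ u in Set.Ioc (0 : ℝ) t, (S k).value u ω ^ 2) k) := by
      intro k
      have hS : ∀ s, Measurable ((S k).integral B s) := fun s =>
        ((S k).measurable_integral hB s).mono (ℱ.le s) le_rfl
      refine Measurable.sub (Finset.measurable_sum _ fun i _ =>
        ((hS _).sub (hS _)).pow_const 2) ?_
      exact ((S k).measurable_value.pow_const 2).stronglyMeasurable.integral_prod_left'.measurable
    refine tendstoInMeasure_of_tendsto_eLpNorm two_ne_zero
      (fun k => (hm k).aestronglyMeasurable) aestronglyMeasurable_const ?_
    have hlim : Tendsto (fun k : ℕ => ENNReal.ofReal (1 / ((k : ℝ) + 1))) atTop (𝓝 0) := by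
      have := ENNReal.tendsto_ofReal (tendsto_one_div_add_atTop_nhds_zero_nat (𝕜 := ℝ))
      simpa using this
    refine tendsto_of_tendsto_of_tendsto_of_le_of_le tendsto_const_nhds hlim (fun _ => zero_le)
      fun k => ?_
    have h1 := (S k).eLpNorm_sum_sq_sub_le hB (hC k) (hp k) (hp0 k) (href' k) (hmesh k)
    rw [hpN k] at h1
    refine (ENNReal.pow_le_pow_left_iff two_ne_zero).1 (le_trans (le_of_eq ?_) (h1.trans ?_))
    · congr 2
      ext ω
      simp
    · rw [← ENNReal.ofReal_pow (by positivity)]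
      refine ENNReal.ofReal_le_ofReal ?_
      have h2 : C k ^ 4 * gaussianSqVar * (δ k * t) = K k * δ k := by rw [hK]; ring
      rw [h2, hδ]
      push_cast
      rw [Real.coe_toNNReal _ (hK0 k), mul_div_assoc', div_le_iff₀ (by linarith [hK0 k]), mul_comm]
      refine mul_le_mul_of_nonneg_left ?_ (by positivity)
      linarith

/-- The quadratic variation of an Itô process `dX = - V / 2 dt + √V dB` is `∫ V dt`. -/
theorem IsQuadraticVariation.ae_eq_integral (hB : IsFilteredBrownian Q ℱ B) {V : ℝ → Ω → ℝ}
    (hV0 : ∀ t, 0 ≤ t → ∀ ω, 0 ≤ V t ω)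
    (hVm : ∀ t : ℝ≥0, AEStronglyMeasurable (Function.uncurry V)
      ((volume.restrict (Set.Ioc (0 : ℝ) t)).prod Q))
    {M : ℝ≥0 → Ω → ℝ} (hM : ∀ t, IsItoIntegral Q ℱ B (fun u ω => √(V u ω)) t (M t))
    {X q : ℝ≥0 → Ω → ℝ}
    (hX : ∀ t : ℝ≥0, ∀ᵐ ω ∂Q, X t ω = -(1 / 2) * (∫ s in (0 : ℝ)..t, V s ω) + M t ω)
    (hq : IsQuadraticVariation Q X q) (t : ℝ≥0) :
    Integrable (Function.uncurry V) ((volume.restrict (Set.Ioc (0 : ℝ) t)).prod Q) ∧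
      q t =ᵐ[Q] fun ω => ∫ s in (0 : ℝ)..t, V s ω := by
  set φ : ℝ × Ω → ℝ := Function.uncurry fun u ω => √(V u ω) with hφ
  have hφm : ∀ s : ℝ≥0, AEStronglyMeasurable φ ((volume.restrict (Set.Ioc (0 : ℝ) s)).prod Q) :=
    fun s => Real.continuous_sqrt.comp_aestronglyMeasurable (hVm s)
  have hMi : ∀ s, HasItoIntegral Q ℱ B (onIoc 0 s φ) (M s) := fun s =>
    (hM s).hasItoIntegral hB (hφm s)
  have hφL : MemLp φ 2 ((volume.restrict (Set.Ioc (0 : ℝ) t)).prod Q) :=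
    (memLp_onIoc 0 t).1 (hMi t).1
  have hVi : Integrable (Function.uncurry V) ((volume.restrict (Set.Ioc (0 : ℝ) t)).prod Q) := by
    refine hφL.integrable_sq.congr ?_
    have h1 : ∀ᵐ x ∂((volume.restrict (Set.Ioc (0 : ℝ) t)).prod Q), x.1 ∈ Set.Ioc (0 : ℝ) t :=
      Measure.quasiMeasurePreserving_fst.ae (ae_restrict_mem measurableSet_Ioc)
    filter_upwards [h1] with x hx
    exact Real.sq_sqrt (hV0 _ hx.1.le _)
  refine ⟨hVi, ?_⟩
  obtain ⟨-, S, hS, -⟩ := hM t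
  obtain ⟨N, p, hp, hp0, hpN, hmesh, h2⟩ := exists_partition_simpleProcess hB S t
  have hS2 : Tendsto (fun k => eLpNorm (fun x : ℝ × Ω => (S k).value x.1 x.2 - φ x) 2
      ((volume.restrict (Set.Ioc (0 : ℝ) t)).prod Q) ^ 2) atTop (𝓝 0) := by
    have := ENNReal.Tendsto.pow (n := 2) hS
    rwa [zero_pow two_ne_zero] at this
  have hSm : ∀ k s, Measurable ((S k).integral B s) := fun k s =>
    ((S k).measurable_integral hB s).mono (ℱ.le s) le_rfl
  have hMm : ∀ s, AEStronglyMeasurable (M s) Q := fun s => (hM s).1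
  have hdm : ∀ k, AEStronglyMeasurable (fun x : ℝ × Ω => (S k).value x.1 x.2 - φ x)
      ((volume.restrict (Set.Ioc (0 : ℝ) t)).prod Q) := fun k =>
    (S k).measurable_value.aestronglyMeasurable.sub (hφm t)
  set I : ℕ → ℝ≥0 → Ω → ℝ := fun k s ω => (S k).integral B s ω - M s ω with hI
  have hIm : ∀ k s, AEStronglyMeasurable (I k s) Q := fun k s =>
    (hSm k s).aestronglyMeasurable.sub (hMm s)
  have h1 : TendstoInMeasure Q (fun k ω => ∑ i ∈ Finset.range (N k),
      (I k (p k (i + 1)) ω - I k (p k i) ω) ^ 2) atTop fun _ => 0 := by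
    refine tendstoInMeasure_of_lintegral (fun k => ?_) (hS2.congr fun k => ?_)
    · exact Finset.aestronglyMeasurable_fun_sum _ fun i _ => ((hIm k _).sub (hIm k _)).pow 2
    · have hIi : ∀ s, HasItoIntegral Q ℱ B
          (onIoc 0 s fun x : ℝ × Ω => (S k).value x.1 x.2 - φ x) (I k s) := fun s => by
        have := ((S k).hasItoIntegral hB s).sub (hMi s)
        rw [← onIoc_sub] at this
        exact this
      rw [← hpN k, ← lintegral_sum_sq_increments hB hIi (hp k) (hp0 k), ← lintegral_finsetSum']
      · refine lintegral_congr fun ω => ?_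
        rw [Real.enorm_of_nonneg (Finset.sum_nonneg fun _ _ => sq_nonneg _),
          ENNReal.ofReal_sum_of_nonneg fun _ _ => sq_nonneg _]
        refine Finset.sum_congr rfl fun i _ => ?_
        rw [← Real.enorm_of_nonneg (sq_nonneg _), enorm_pow]
      · exact fun i _ => ((hIm k _).sub (hIm k _)).enorm.pow_const 2
  have h3 : TendstoInMeasure Q (fun k ω => ∫ u in Set.Ioc (0 : ℝ) t,
      ((S k).value u ω - φ (u, ω)) ^ 2) atTop fun _ => 0 := by
    refine tendstoInMeasure_of_lintegral (fun k => ?_) ?_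
    · exact ((hdm k).pow 2).prod_swap.integral_prod_right'
    · refine tendsto_of_tendsto_of_tendsto_of_le_of_le tendsto_const_nhds hS2 (fun _ => zero_le)
        fun k => ?_
      rw [eLpNorm_two_sq, lintegral_prod_symm _ ((hdm k).enorm.pow_const 2)]
      refine lintegral_mono fun ω => (enorm_integral_le_lintegral_enorm _).trans ?_
      simp only [enorm_pow]
      exact le_rfl
  obtain ⟨ns, hns, hae⟩ := exists_seq_tendsto_ae_of_four (hq t N p hp hp0 hpN hmesh) h1 h2 h3
  -- The decomposition of `X` holds almost surely at each fixed time; countably many partition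
  -- points share one null set.
  have hXall : ∀ᵐ ω ∂Q, ∀ k i, X (p k i) ω
      = -(1 / 2) * (∫ s in (0 : ℝ)..p k i, V s ω) + M (p k i) ω :=
    ae_all_iff.2 fun k => ae_all_iff.2 fun i => hX (p k i)
  filter_upwards [hae, hXall, hVi.prod_left_ae] with ω ⟨w0, w1, w2, w3⟩ hXω hVω
  refine tendsto_nhds_unique w0 ?_
  have hVω' : IntegrableOn (fun u => V u ω) (Set.Ioc 0 t) volume := hVω
  set A : ℝ → ℝ := fun s => ∫ u in (0 : ℝ)..s, V u ω with hA
  have hint : ∀ {a b : ℝ}, 0 ≤ a → a ≤ b → b ≤ t →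
      IntervalIntegrable (fun u => V u ω) volume a b := fun h0 hab hb => by
    rw [intervalIntegrable_iff_integrableOn_Ioc_of_le hab]
    exact hVω'.mono_set (Set.Ioc_subset_Ioc h0 hb)
  have hAc : ContinuousOn A (Set.Icc 0 t) := by
    have := intervalIntegral.continuousOn_primitive_interval (μ := volume)
      (f := fun u => V u ω) (a := 0) (b := t) (by
        rw [Set.uIcc_of_le t.coe_nonneg, integrableOn_Icc_iff_integrableOn_Ioc]; exact hVω')
    rwa [Set.uIcc_of_le t.coe_nonneg] at this
  have hAm : MonotoneOn A (Set.Icc 0 t) := by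
    intro a ha b hb hab
    have h := intervalIntegral.integral_add_adjacent_intervals
      (hint le_rfl ha.1 ha.2) (hint ha.1 hab hb.2)
    have h0 : 0 ≤ ∫ u in a..b, V u ω :=
      intervalIntegral.integral_nonneg hab fun u hu => hV0 u (ha.1.trans hu.1) ω
    simp only [hA]
    linarith
  have hAq := (tendsto_sum_sq_increments_of_monotoneOn hAc hAm hp hp0 hpN hmesh).comp hns
  have hφω : MemLp (fun u => φ (u, ω)) 2 (volume.restrict (Set.Ioc (0 : ℝ) t)) := by
    have hm : AEStronglyMeasurable (fun u => φ (u, ω)) (volume.restrict (Set.Ioc (0 : ℝ) t)) :=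
      Real.continuous_sqrt.comp_aestronglyMeasurable hVω.aestronglyMeasurable
    rw [memLp_two_iff_integrable_sq hm]
    refine hVω.congr ?_
    filter_upwards [ae_restrict_mem measurableSet_Ioc] with u hu
    exact (Real.sq_sqrt (hV0 _ hu.1.le _)).symm
  have hL : ∫ s in (0 : ℝ)..t, V s ω = ∫ u in Set.Ioc (0 : ℝ) t, φ (u, ω) ^ 2 := by
    rw [intervalIntegral.integral_of_le t.coe_nonneg]
    refine setIntegral_congr_fun measurableSet_Ioc fun u hu => ?_
    exact (Real.sq_sqrt (hV0 _ hu.1.le _)).symm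
  rw [hL]
  have : IsFiniteMeasure (volume.restrict (Set.Ioc (0 : ℝ) t)) := ⟨by simp⟩
  refine tendsto_of_abs_sqrt_sub_le (fun k => Finset.sum_nonneg fun _ _ => sq_nonneg _)
    (fun k => integral_nonneg fun _ => sq_nonneg _) (integral_nonneg fun _ => sq_nonneg _)
    (fun k => abs_sqrt_sum_sq_sub_le _ _ fun i =>
      (S (ns k)).integral B (p (ns k) (i + 1)) ω - (S (ns k)).integral B (p (ns k) i) ω) ?_ w2
    (fun k => abs_sqrt_integral_sq_sub_le ((S (ns k)).memLp_value ω 2) hφω) w3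
  -- The increments of `X` and of the simple integral differ by half an increment of `A` and one of
  -- `I`; the weights come from `(a + b)² ≤ 2a² + 2b²`.
  have hup := (hAq.const_mul (1 / 2)).add (w1.const_mul 2)
  simp only [mul_zero, add_zero] at hup
  refine squeeze_zero (fun k => Finset.sum_nonneg fun _ _ => sq_nonneg _) (fun k => ?_) hup
  simp only [Function.comp_apply]
  rw [Finset.mul_sum, Finset.mul_sum, ← Finset.sum_add_distrib]
  refine Finset.sum_le_sum fun i _ => ?_
  rw [hXω, hXω]
  simp only [hI]
  nlinarith [sq_nonneg ((A (p (ns k) (i + 1)) - A (p (ns k) i)) / 2 +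
    ((M (p (ns k) (i + 1)) ω - M (p (ns k) i) ω) -
      ((S (ns k)).integral B (p (ns k) (i + 1)) ω - (S (ns k)).integral B (p (ns k) i) ω)))]

end ItoQuadraticVariation

/-! ### Realised variance as a time integral of `V` -/

section RealisedVariance

variable {Ω : Type*} {mΩ : MeasurableSpace Ω} {Q : Measure Ω} [IsProbabilityMeasure Q]
  {ℱ : Filtration ℝ≥0 mΩ} {H ν ρ : ℝ} {W Z : ℝ≥0 → Ω → ℝ} {ξ₀ 𝒱 : ℝ → Ω → ℝ} {X : ℝ≥0 → Ω → ℝ}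

lemma IsModel.measurable_ξ₀ (hM : IsModel Q ℱ H ν ρ W Z ξ₀ 𝒱 X) :
    Measurable (Function.uncurry ξ₀) :=
  hM.ξ₀_measurable.mono (sup_le_sup le_rfl (MeasurableSpace.comap_mono (ℱ.le 0))) le_rfl

lemma IsModel.aestronglyMeasurable_instVariance (hM : IsModel Q ℱ H ν ρ W Z ξ₀ 𝒱 X) (t : ℝ≥0) :
    AEStronglyMeasurable (Function.uncurry (instVariance H ν ξ₀ 𝒱))
      ((volume.restrict (Set.Ioc (0 : ℝ) t)).prod Q) := by
  have hm : Measurable fun x : ℝ × Ω => Function.uncurry ξ₀ x * Real.exp (2 * ν * cH H *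
      Function.uncurry 𝒱 x - (2 * ν * cH H) ^ 2 * (x.1 ^ (2 * H) / (2 * H)) / 2) := by
    have h1 := hM.measurable_ξ₀
    have h2 := hM.volterra_measurable
    fun_prop
  -- The closed form of the bracket, valid for nonnegative times, makes joint measurability evident.
  refine hm.aestronglyMeasurable.congr ?_
  have h1 : ∀ᵐ x ∂((volume.restrict (Set.Ioc (0 : ℝ) t)).prod Q), x.1 ∈ Set.Ioc (0 : ℝ) t :=
    Measure.quasiMeasurePreserving_fst.ae (ae_restrict_mem measurableSet_Ioc)
  filter_upwards [h1] with x hx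
  rw [← volterraBracket_eq hM.H_pos hx.1.le]
  rfl

lemma IsModel.instVariance_nonneg (hM : IsModel Q ℱ H ν ρ W Z ξ₀ 𝒱 X) {t : ℝ} (ht : 0 ≤ t) (ω : Ω) :
    0 ≤ instVariance H ν ξ₀ 𝒱 t ω :=
  mul_nonneg (hM.ξ₀_pos t ht ω).le (Real.exp_nonneg _)

lemma IsModel.integrable_instVariance_and_quadraticVariation
    (hM : IsModel Q ℱ H ν ρ W Z ξ₀ 𝒱 X) {q : ℝ≥0 → Ω → ℝ} (hq : IsQuadraticVariation Q X q)
    (t : ℝ≥0) :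
    Integrable (Function.uncurry (instVariance H ν ξ₀ 𝒱))
      ((volume.restrict (Set.Ioc (0 : ℝ) t)).prod Q) ∧
      q t =ᵐ[Q] fun ω => ∫ s in (0 : ℝ)..t, instVariance H ν ξ₀ 𝒱 s ω := by
  obtain ⟨M, hMI, hX⟩ := hM.logPrice
  exact IsQuadraticVariation.ae_eq_integral hM.brownian_W
    (fun t ht ω => hM.instVariance_nonneg ht ω) hM.aestronglyMeasurable_instVariance hMI hX hq t

lemma IsModel.integrable_instVariance_Ioc (hM : IsModel Q ℱ H ν ρ W Z ξ₀ 𝒱 X) {q : ℝ≥0 → Ω → ℝ}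
    (hq : IsQuadraticVariation Q X q) (r t : ℝ≥0) :
    Integrable (Function.uncurry (instVariance H ν ξ₀ 𝒱))
      ((volume.restrict (Set.Ioc (r : ℝ) t)).prod Q) := by
  refine (hM.integrable_instVariance_and_quadraticVariation hq t).1.mono_measure ?_
  exact Measure.prod_mono
    (Measure.restrict_mono (Set.Ioc_subset_Ioc_left r.coe_nonneg) le_rfl) le_rfl

lemma IsModel.realisedVariance_ae_eq (hM : IsModel Q ℱ H ν ρ W Z ξ₀ 𝒱 X) {q : ℝ≥0 → Ω → ℝ}
    (hq : IsQuadraticVariation Q X q) (T Δ : ℝ≥0) :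
    realisedVariance q T Δ =ᵐ[Q] fun ω => 1 / (Δ : ℝ) *
      ∫ s in Set.Ioc (T : ℝ) (T + Δ : ℝ≥0), instVariance H ν ξ₀ 𝒱 s ω := by
  obtain ⟨hi, h1⟩ := hM.integrable_instVariance_and_quadraticVariation hq (T + Δ)
  obtain ⟨-, h0⟩ := hM.integrable_instVariance_and_quadraticVariation hq T
  filter_upwards [h0, h1, hi.prod_left_ae] with ω e0 e1 hiω
  have hle : (T : ℝ) ≤ (T + Δ : ℝ≥0) := NNReal.coe_le_coe.2 le_self_add
  have hV : IntegrableOn (fun s => instVariance H ν ξ₀ 𝒱 s ω) (Set.Ioc 0 (T + Δ : ℝ≥0)) := hiω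
  rw [realisedVariance, e0, e1, ← intervalIntegral.integral_of_le hle,
    intervalIntegral.integral_interval_sub_left]
  · rw [intervalIntegrable_iff_integrableOn_Ioc_of_le (NNReal.coe_nonneg _)]
    exact hV
  · rw [intervalIntegrable_iff_integrableOn_Ioc_of_le (NNReal.coe_nonneg _)]
    exact hV.mono_set (Set.Ioc_subset_Ioc_right hle)

end RealisedVariance

end RoughBergomi

/-! ### The VIX formula -/

theorem proposition3p1 {Ω : Type*} {mΩ : MeasurableSpace Ω} (Q : Measure Ω)
    [IsProbabilityMeasure Q] (ℱ : Filtration ℝ≥0 mΩ) (H ν ρ : ℝ) (W Z : ℝ≥0 → Ω → ℝ)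
    (ξ₀ 𝒱 : ℝ → Ω → ℝ) (X : ℝ≥0 → Ω → ℝ)
    (hmodel : RoughBergomi.IsModel Q ℱ H ν ρ W Z ξ₀ 𝒱 X)
    (q : ℝ≥0 → Ω → ℝ) (hq : RoughBergomi.IsQuadraticVariation Q X q)
    (T Δ : ℝ≥0) (hΔ : 0 < Δ)
    (𝒱T : ℝ → Ω → ℝ) (h𝒱T : RoughBergomi.IsTruncatedVolterra Q ℱ H Z T 𝒱T) :
    Integrable (RoughBergomi.realisedVariance q T Δ) Q ∧
    ∀ᵐ ω ∂Q,
      IntervalIntegrable (fun t : ℝ => ξ₀ t ω * RoughBergomi.eta H ν 𝒱T t ω *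
          Real.exp (ν ^ 2 * RoughBergomi.cH H ^ 2 / H *
            ((t - (T : ℝ)) ^ (2 * H) - t ^ (2 * H)))) volume (T : ℝ) ((T : ℝ) + (Δ : ℝ)) ∧
      RoughBergomi.vix Q ℱ q T Δ ω =
        Real.sqrt (1 / (Δ : ℝ) * ∫ t in (T : ℝ)..((T : ℝ) + (Δ : ℝ)),
          ξ₀ t ω * RoughBergomi.eta H ν 𝒱T t ω *
            Real.exp (ν ^ 2 * RoughBergomi.cH H ^ 2 / H *
              ((t - (T : ℝ)) ^ (2 * H) - t ^ (2 * H)))) := by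
  have hle : T ≤ T + Δ := le_self_add
  set μ : Measure ℝ := volume.restrict (Set.Ioc (T : ℝ) (T + Δ : ℝ≥0)) with hμ
  set V := Function.uncurry (RoughBergomi.instVariance H ν ξ₀ 𝒱) with hV
  have hVi : Integrable V (μ.prod Q) := hmodel.integrable_instVariance_Ioc hq T (T + Δ)
  have hR := hmodel.realisedVariance_ae_eq hq T Δ
  set Y : ℝ × Ω → ℝ := fun x => ξ₀ x.1 x.2 * RoughBergomi.eta H ν 𝒱T x.1 x.2 *
    Real.exp (ν ^ 2 * RoughBergomi.cH H ^ 2 / H *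
      ((x.1 - (T : ℝ)) ^ (2 * H) - x.1 ^ (2 * H))) with hY
  have hYm : AEStronglyMeasurable Y (μ.prod Q) := by
    have h1 : Measurable fun x : ℝ × Ω => ξ₀ x.1 x.2 := hmodel.measurable_ξ₀
    have h2 : Measurable fun x : ℝ × Ω => 𝒱T x.1 x.2 := h𝒱T.measurable
    simp only [hY, RoughBergomi.eta]
    exact Measurable.aestronglyMeasurable (by fun_prop)
  have hcond : ∀ᵐ s ∂μ, Q[fun ω => V (s, ω)|ℱ T] =ᵐ[Q] fun ω => Y (s, ω) := by
    -- Fubini gives integrability of `V_s` only for almost every `s`, which is enough under the time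
    -- integral.
    filter_upwards [hVi.prod_right_ae, ae_restrict_mem measurableSet_Ioc] with s hs hsm
    have hs0 : 0 ≤ s := T.coe_nonneg.trans hsm.1.le
    exact hmodel.condExp_instVariance (s := ⟨s, hs0⟩) hsm.1.le h𝒱T hs
  have hYi : Integrable Y (μ.prod Q) := RoughBergomi.integrable_of_condExp_eq hVi hYm hcond
  have hint : Integrable (fun ω => 1 / (Δ : ℝ) * ∫ s, V (s, ω) ∂μ) Q :=
    hVi.integral_prod_right.const_mul _
  refine ⟨hint.congr hR.symm, ?_⟩
  have hΔT : (T : ℝ) ≤ (T : ℝ) + Δ := le_add_of_nonneg_right Δ.coe_nonneg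
  have e1 : Q[RoughBergomi.realisedVariance q T Δ|ℱ T]
      =ᵐ[Q] Q[(1 / (Δ : ℝ)) • fun ω => ∫ s, V (s, ω) ∂μ|ℱ T] := condExp_congr_ae hR
  filter_upwards [e1, condExp_smul (μ := Q) (1 / (Δ : ℝ)) (fun ω => ∫ s, V (s, ω) ∂μ) (ℱ T),
    RoughBergomi.condExp_integral (ℱ.le T) hVi hYi hcond, hYi.prod_left_ae] with ω h1 h2 h3 h4
  refine ⟨?_, ?_⟩
  · rw [intervalIntegrable_iff_integrableOn_Ioc_of_le hΔT, ← NNReal.coe_add]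
    exact h4
  · rw [RoughBergomi.vix, h1, h2, Pi.smul_apply, h3, intervalIntegral.integral_of_le hΔT,
      smul_eq_mul, ← NNReal.coe_add]
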